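/- Let $0<T\le\infty$ and let $(\mathbf u,p)$ be a smooth solution of the 3D incompressible Euler equations $\partial_t\mathbf u+(\mathbf u\cdot\nabla)\mathbf u+\nabla p=0$, $\nabla\cdot\mathbf u=0$ on $\mathbb R^3\times[0,T)$. Write $\omega=\nabla\times\mathbf u$, $\Omega(t)=\|\omega(\cdot,t)\|_{L^\infty}$ and, where $\omega\neq0$, $\xi=\omega/|\omega|$, $\kappa=|(\xi\cdot\nabla)\xi|$, $\tau=\nabla\cdot\xi$. Let $0\le T_0<T$ and let $L^t=\{\mathbf x(s,t):0\le s\le L(t)\}$, $T_0\le t<T$, be a family of vortex line segments ($L(t)>0$, $\omega\ne0$ on $L^t$, $s$ is the arclength in the direction of $\xi$) which come from the same vortex line, that is, every $L^t$ is a piece of the image under the flow of $\mathbf u$ from time $T_0$ to time $t$ of one fixed vortex line of time $T_0$; the initial end point $\mathbf x(0,t)$ is differentiable in $t$, and its Lagrangian label on that line is continuous in $t$. Put $$\Omega_L(t)=\max_{L^t}|\omega|,\qquad V(t)=\max_{L^t}|\mathbf u\cdot\xi|,\qquad Q(t)=\frac1{L(t)}\int_0^{L(t)}|\omega(\mathbf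 x(s,t),t)|\,ds .$$ Suppose that there are constants $0<c_0\le1$ and $C_0,C_l,C_u,L_0>0$ such that for all $t\in[T_0,T)$ $$\Omega_L(t)\ge c_0\,\Omega(t),\qquad |\omega(\mathbf x(L(t),t),t)|=\Omega_L(t),\qquad \int_{L^t}|\kappa|\,ds\le C_0,\qquad \int_{L^t}|\tau|\,ds\le C_0,$$ $$\Bigl|\frac{d\mathbf x(0,t)}{dt}\cdot\xi(\mathbf x(0,t),t)\Bigr|\le C_l\,V(t),\qquad \max_{L^t}|\mathbf u|\le C_u\log\Omega(t),\qquad L(t)\ge L_0 .$$ Then $\Omega$ grows no faster than double exponentially in time: there are a constant $A>0$ that depends only on $c_0,C_0$ and a constant $B>0$ that depends only on $C_0,C_l,C_u,L_0$ (in particular neither depends on the solution, on $T$ or on $T_0$) such that $$\Omega(t)\le\exp\Bigl(\log\bigl(A\,Q(T_0)\bigr)\,\exp\bigl(B\,(t-T_0)\bigr)\Bigr)\qquad\text{for all } t\in[T_0,T).$$ -/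

import Mathlib

open Set MeasureTheory
open scoped ENNReal ContDiff

namespace EulerVortex

/-- Physical space `ℝ³` with its Euclidean norm. -/
abbrev E3 : Type := EuclideanSpace ℝ (Fin 3)

/-- The partial derivative `∂_i F_j` of a vector field at `y`. -/
noncomputable def partialD (F : E3 → E3) (i j : Fin 3) (y : E3) : ℝ :=
  (fderiv ℝ F y (EuclideanSpace.single i 1)) j

/-- The divergence of a vector field on `ℝ³`. -/
noncomputable def divergence (F : E3 → E3) (y : E3) : ℝ :=
  ∑ i : Fin 3, partialD F i i y

/-- The curl of a vector field on `ℝ³`. -/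
noncomputable def curl (F : E3 → E3) (y : E3) : E3 :=
  !₂[partialD F 1 2 y - partialD F 2 1 y,
     partialD F 2 0 y - partialD F 0 2 y,
     partialD F 0 1 y - partialD F 1 0 y]

/-- The times `0 ≤ t < T`; the final time `T` may be `+∞`. -/
def timeInterval (T : EReal) : Set ℝ := {t | 0 ≤ t ∧ (t : EReal) < T}

/-- A smooth solution `(u, p)` of the incompressible Euler equations on `ℝ³ × [0, T)`:
`∂_t u + (u · ∇) u + ∇ p = 0`, `∇ · u = 0`. The time variable comes first. -/
structure IsEulerSolution (T : EReal) (u : ℝ → E3 → E3) (p : ℝ → E3 → ℝ) : Prop where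
  smooth_velocity :
    ContDiffOn ℝ ∞ (fun z : ℝ × E3 => u z.1 z.2) (timeInterval T ×ˢ univ)
  smooth_pressure :
    ContDiffOn ℝ ∞ (fun z : ℝ × E3 => p z.1 z.2) (timeInterval T ×ˢ univ)
  momentum : ∀ t ∈ timeInterval T, ∀ y : E3,
    derivWithin (fun r => u r y) (timeInterval T) t + fderiv ℝ (u t) y (u t y)
      + gradient (p t) y = 0
  incompressible : ∀ t ∈ timeInterval T, ∀ y : E3, divergence (u t) y = 0

/-- The vorticity `ω = ∇ × u`. -/
noncomputable def vorticity (u : ℝ → E3 → E3) (t : ℝ) (y : E3) : E3 := curl (u t) y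

/-- `Ω(t) = ‖ω(·, t)‖_{L^∞}`, with values in `[0, ∞]`. -/
noncomputable def maxVorticity (u : ℝ → E3 → E3) (t : ℝ) : ℝ≥0∞ :=
  eLpNorm (vorticity u t) ∞ volume

/-- The unit vorticity vector `ξ = ω / |ω|`. -/
noncomputable def xi (u : ℝ → E3 → E3) (t : ℝ) (y : E3) : E3 :=
  ‖vorticity u t y‖⁻¹ • vorticity u t y

/-- The curvature `κ = |(ξ · ∇) ξ|` of vortex lines. -/
noncomputable def kappa (u : ℝ → E3 → E3) (t : ℝ) (y : E3) : ℝ :=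
  ‖fderiv ℝ (xi u t) y (xi u t y)‖

/-- `τ = ∇ · ξ`. -/
noncomputable def tau (u : ℝ → E3 → E3) (t : ℝ) (y : E3) : ℝ := divergence (xi u t) y

/-- A vortex line transported by the flow from time `T₀` on. At time `T₀` the curve
`β ↦ Y T₀ β` (`β` in the interval `J`) is a vortex line parametrized by arclength; for each
label `β` the curve `t ↦ Y t β`, `T₀ ≤ t < T`, is a particle trajectory of `u`. -/
structure IsMaterialVortexLine (T : EReal) (u : ℝ → E3 → E3) (T₀ : ℝ)
    (J : Set ℝ) (Y : ℝ → ℝ → E3) : Prop where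
  interval : J.OrdConnected
  nonvanishing : ∀ β ∈ J, vorticity u T₀ (Y T₀ β) ≠ 0
  initial_line : ∀ β ∈ J, HasDerivWithinAt (Y T₀) (xi u T₀ (Y T₀ β)) J β
  trajectory : ∀ β ∈ J, ∀ t : ℝ, T₀ ≤ t → (t : EReal) < T →
    HasDerivWithinAt (fun r => Y r β) (u t (Y t β)) (Ici T₀) t

/-- A family of vortex line segments `L^t = {x t s : 0 ≤ s ≤ L t}`, `T₀ ≤ t < T`, coming from
the same vortex line. For each time `t`, `s ↦ x t s` is the arclength parametrization
(in the direction of `ξ`) of a piece of a vortex line, and this piece is part of the image under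
the flow of one vortex line of time `T₀`: the point `x t s` carries the label `lab t s`.
The initial end point `x t 0` moves continuously along the line and differentiably in space. -/
structure IsVortexSegmentFamily (T : EReal) (u : ℝ → E3 → E3) (T₀ : ℝ)
    (x : ℝ → ℝ → E3) (L : ℝ → ℝ) : Prop where
  length_pos : ∀ t : ℝ, T₀ ≤ t → (t : EReal) < T → 0 < L t
  nonvanishing : ∀ t : ℝ, T₀ ≤ t → (t : EReal) < T → ∀ s ∈ Icc 0 (L t),
    vorticity u t (x t s) ≠ 0
  arclength : ∀ t : ℝ, T₀ ≤ t → (t : EReal) < T → ∀ s ∈ Icc 0 (L t),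
    HasDerivWithinAt (x t) (xi u t (x t s)) (Icc 0 (L t)) s
  same_line : ∃ (J : Set ℝ) (Y : ℝ → ℝ → E3) (lab : ℝ → ℝ → ℝ),
    IsMaterialVortexLine T u T₀ J Y ∧
    (∀ t : ℝ, T₀ ≤ t → (t : EReal) < T →
      ContinuousOn (lab t) (Icc 0 (L t)) ∧ StrictMonoOn (lab t) (Icc 0 (L t)) ∧
      ∀ s ∈ Icc 0 (L t), lab t s ∈ J ∧ x t s = Y t (lab t s)) ∧
    ContinuousOn (fun t => lab t 0) {t : ℝ | T₀ ≤ t ∧ (t : EReal) < T}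
  start_differentiable : ∀ t : ℝ, T₀ ≤ t → (t : EReal) < T →
    DifferentiableWithinAt ℝ (fun r => x r 0) (Ici T₀) t

/-- `Ω_L(t)`, the maximum of `|ω|` along `L^t`. -/
noncomputable def segMaxVorticity (u : ℝ → E3 → E3) (x : ℝ → ℝ → E3) (L : ℝ → ℝ) (t : ℝ) : ℝ :=
  sSup ((fun s => ‖vorticity u t (x t s)‖) '' Icc 0 (L t))

/-- `V(t)`, the maximum of `|u · ξ|` along `L^t`. -/
noncomputable def segMaxTangentialSpeed (u : ℝ → E3 → E3) (x : ℝ → ℝ → E3) (L : ℝ → ℝ)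
    (t : ℝ) : ℝ :=
  sSup ((fun s => |inner ℝ (u t (x t s)) (xi u t (x t s))|) '' Icc 0 (L t))

/-- The maximum of `|u|` along `L^t`. -/
noncomputable def segMaxSpeed (u : ℝ → E3 → E3) (x : ℝ → ℝ → E3) (L : ℝ → ℝ) (t : ℝ) : ℝ :=
  sSup ((fun s => ‖u t (x t s)‖) '' Icc 0 (L t))

/-- `Q(t)`, the mean of `|ω|` along `L^t`. -/
noncomputable def segMeanVorticity (u : ℝ → E3 → E3) (x : ℝ → ℝ → E3) (L : ℝ → ℝ) (t : ℝ) : ℝ :=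
  (1 / L t) * ∫ s in (0 : ℝ)..(L t), ‖vorticity u t (x t s)‖

/-- The hypotheses on the family `L^t`, `T₀ ≤ t < T`, with constants `c₀, C₀, C_l, C_u`: the
vorticity on `L^t` is comparable with the maximum vorticity and is largest at the end point
`s = L t`; `∫ |κ| ds` and `∫ |τ| ds` are at most `C₀`; the tangential velocity of the initial end
point is at most `C_l V(t)`; and the velocity on `L^t` is at most `C_u log Ω(t)`. -/
structure LogVelocityHypotheses (T : EReal) (u : ℝ → E3 → E3) (T₀ : ℝ)
    (x : ℝ → ℝ → E3) (L : ℝ → ℝ) (c₀ C₀ Cl Cu : ℝ) : Prop where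
  family : IsVortexSegmentFamily T u T₀ x L
  comparable : ∀ t : ℝ, T₀ ≤ t → (t : EReal) < T →
    ENNReal.ofReal c₀ * maxVorticity u t ≤ ENNReal.ofReal (segMaxVorticity u x L t)
  max_at_end : ∀ t : ℝ, T₀ ≤ t → (t : EReal) < T →
    ‖vorticity u t (x t (L t))‖ = segMaxVorticity u x L t
  curvature_bound : ∀ t : ℝ, T₀ ≤ t → (t : EReal) < T →
    ∫ s in (0 : ℝ)..(L t), |kappa u t (x t s)| ≤ C₀
  divergence_bound : ∀ t : ℝ, T₀ ≤ t → (t : EReal) < T →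
    ∫ s in (0 : ℝ)..(L t), |tau u t (x t s)| ≤ C₀
  start_speed_bound : ∀ t : ℝ, T₀ ≤ t → (t : EReal) < T →
    |inner ℝ (derivWithin (fun r => x r 0) (Ici T₀) t) (xi u t (x t 0))|
      ≤ Cl * segMaxTangentialSpeed u x L t
  log_velocity : ∀ t : ℝ, T₀ ≤ t → (t : EReal) < T →
    segMaxSpeed u x L t ≤ Cu * Real.log (maxVorticity u t).toReal

end EulerVortex

/-! The measure ds/|ω| on a vortex line is transported by the flow. Along trajectories dω/dt =
(∇u)ω, which is the linearized flow equation; so a material vortex line stays a vortex line, and its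
line element stretches exactly like |ω| (Helmholtz). Fix ℓ = L₀/2 and let M(t) be the integral of
ds/|ω| over the first ℓ units of length of L^t. Then M changes only because the two ends of this
piece move relative to the fluid.

Both end speeds are controlled by U = max |u| on L^t. The initial end has tangential speed at most
(C_l + 1)U relative to the fluid, by hypothesis. The piece has constant length, so the relative
speed of the other end differs from this by the total stretching ∫ ξ·(∇u)ξ ds. An integration by
parts turns the latter into the boundary term [u·ξ] minus ∫ u·(ξ·∇)ξ ds, which is at most (2 + C₀)U.

Since ∇·ω = 0, τ is the derivative of -log|ω| along the line, and ∫|τ| ds ≤ C₀ makes all values of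
|ω| on L^t comparable up to the factor e^{C₀}. Hence M is comparable with ℓ/Ω_L, and |d log M/dt| is
at most a constant times U/ℓ. The quantity z = log(e^{C₀}ℓ/(c₀M)) dominates log Ω, so U ≤ C_u log Ω
gives z' ≤ Bz, and Grönwall's inequality gives the double exponential. Working with M at fixed
length avoids differentiating Ω_L or L in time.

The carrying lemmas are `IsEulerSolution.vorticity_along`,
`IsMaterialVortexLine.hasDerivWithinAt_label`, `norm_vorticity_le_exp_mul`,
`abs_integral_stretching_le`, `exists_hasDerivWithinAt_integral_of_mass_eq` and
`LogVelocityHypotheses.exists_hasDerivWithinAt_mass`. -/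

namespace EulerVortex

/-! ### Calculus on a space-time slab, with one-sided time derivatives at its boundary -/

section Slab

variable {E G : Type*} [NormedAddCommGroup E] [NormedSpace ℝ E]
  [NormedAddCommGroup G] [NormedSpace ℝ G]

theorem contDiff_slice {I : Set ℝ} {f : ℝ → E → G}
    (hf : ContDiffOn ℝ ∞ (fun z : ℝ × E => f z.1 z.2) (I ×ˢ univ)) {t : ℝ} (ht : t ∈ I) :
    ContDiff ℝ ∞ (f t) := by
  rw [← contDiffOn_univ]
  exact hf.comp (f := fun y : E => (t, y)) (by fun_prop) (fun y _ => ⟨ht, mem_univ _⟩)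

theorem hasFDerivAt_slice {I : Set ℝ} {f : ℝ → E → G}
    (hf : ContDiffOn ℝ ∞ (fun z : ℝ × E => f z.1 z.2) (I ×ˢ univ)) {t : ℝ} (ht : t ∈ I) (y : E) :
    HasFDerivAt (f t) ((fderivWithin ℝ (fun z : ℝ × E => f z.1 z.2) (I ×ˢ univ) (t, y)).comp
      (ContinuousLinearMap.inr ℝ ℝ E)) y := by
  rw [← hasFDerivWithinAt_univ]
  have h1 := ((hf.differentiableOn (by simp)) (t, y) ⟨ht, mem_univ _⟩).hasFDerivWithinAt
  exact h1.comp (f := fun y : E => (t, y)) y (hasFDerivAt_prodMk_right t y).hasFDerivWithinAt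
    (fun y _ => ⟨ht, mem_univ _⟩)

theorem hasDerivWithinAt_slice {I : Set ℝ} {f : ℝ → E → G}
    (hf : ContDiffOn ℝ ∞ (fun z : ℝ × E => f z.1 z.2) (I ×ˢ univ)) {t : ℝ} (ht : t ∈ I) (y : E) :
    HasDerivWithinAt (fun r => f r y)
      (fderivWithin ℝ (fun z : ℝ × E => f z.1 z.2) (I ×ˢ univ) (t, y) (1, 0)) I t := by
  have h1 := ((hf.differentiableOn (by simp)) (t, y) ⟨ht, mem_univ _⟩).hasFDerivWithinAt
  exact h1.comp_hasDerivWithinAt (f := fun r : ℝ => (r, y)) t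
    ((hasDerivWithinAt_id t I).prodMk (hasDerivWithinAt_const t I y))
    (fun y hy => ⟨hy, mem_univ _⟩)

/-- The space derivative is the within-derivative on the slab restricted to the directions (0, v),
so joint smoothness persists up to a closed end of the time interval without extending `f` past it.
-/
theorem contDiffOn_fderiv_slice {I : Set ℝ} (hI : UniqueDiffOn ℝ I) {f : ℝ → E → G}
    (hf : ContDiffOn ℝ ∞ (fun z : ℝ × E => f z.1 z.2) (I ×ˢ univ)) :
    ContDiffOn ℝ ∞ (fun z : ℝ × E => fderiv ℝ (f z.1) z.2) (I ×ˢ univ) := by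
  have h1 := hf.fderivWithin (hI.prod uniqueDiffOn_univ) (m := ∞) (by simp)
  have h2 := h1.clm_comp (contDiffOn_const (c := ContinuousLinearMap.inr ℝ ℝ E))
  exact h2.congr fun z hz => (hasFDerivAt_slice hf hz.1 z.2).fderiv

/-- The time derivative along a curve of a function on a slab. -/
theorem hasDerivWithinAt_along {I K : Set ℝ} {f : ℝ → E → G}
    (hf : ContDiffOn ℝ ∞ (fun z : ℝ × E => f z.1 z.2) (I ×ˢ univ)) {t : ℝ} (ht : t ∈ I)
    (hI : UniqueDiffWithinAt ℝ I t) (hK : K ⊆ I)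
    {y : ℝ → E} {v : E} (hy : HasDerivWithinAt y v K t) :
    HasDerivWithinAt (fun r => f r (y r))
      (derivWithin (fun r => f r (y t)) I t + fderiv ℝ (f t) (y t) v) K t := by
  have h1 := ((hf.differentiableOn (by simp)) (t, y t) ⟨ht, mem_univ _⟩).hasFDerivWithinAt
  have h2 := h1.comp_hasDerivWithinAt (f := fun r : ℝ => (r, y r)) t
    ((hasDerivWithinAt_id t K).prodMk hy)
    (fun r hr => ⟨hK hr, mem_univ _⟩)
  rw [(hasDerivWithinAt_slice hf ht (y t)).derivWithin hI, (hasFDerivAt_slice hf ht (y t)).fderiv]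
  refine h2.congr_deriv ?_
  rw [ContinuousLinearMap.comp_apply, ← map_add]
  simp

/-- The time derivative and the space derivative commute. -/
theorem hasFDerivAt_derivWithin_slice {I : Set ℝ} (hI : Convex ℝ I) (hI' : (interior I).Nonempty)
    {f : ℝ → E → G}
    (hf : ContDiffOn ℝ ∞ (fun z : ℝ × E => f z.1 z.2) (I ×ˢ univ)) {t : ℝ} (ht : t ∈ I) (y : E) :
    HasFDerivAt (fun y => derivWithin (fun r => f r y) I t)
      (derivWithin (fun r => fderiv ℝ (f r) y) I t) y := by
  have hU : UniqueDiffOn ℝ I := uniqueDiffOn_convex hI hI'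
  have hS : UniqueDiffOn ℝ (I ×ˢ (univ : Set E)) := hU.prod uniqueDiffOn_univ
  set F := fderivWithin ℝ (fun z : ℝ × E => f z.1 z.2) (I ×ˢ univ) with hF
  have hFs : ContDiffOn ℝ ∞ F (I ×ˢ univ) := hf.fderivWithin hS (by simp)
  have hd := ((hFs.differentiableOn (by simp)) (t, y) ⟨ht, mem_univ _⟩).hasFDerivWithinAt
  have hsym : IsSymmSndFDerivWithinAt ℝ (fun z : ℝ × E => f z.1 z.2) (I ×ˢ univ) (t, y) := by
    refine (hf (t, y) ⟨ht, mem_univ _⟩).isSymmSndFDerivWithinAt ?_ hS ?_ ⟨ht, mem_univ _⟩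
    · rw [minSmoothness_of_isRCLikeNormedField]; exact WithTop.coe_le_coe.2 le_top
    -- Boundary times such as t = 0 are covered because a convex set with nonempty interior lies in
    -- the closure of its interior.
    · rw [interior_prod_eq, interior_univ, closure_prod_eq, closure_univ]
      refine ⟨?_, mem_univ _⟩
      rw [hI.closure_interior_eq_closure_of_nonempty_interior hI']
      exact subset_closure ht
  have h1 : HasFDerivAt (fun y => F (t, y))
      ((fderivWithin ℝ F (I ×ˢ univ) (t, y)).comp (ContinuousLinearMap.inr ℝ ℝ E)) y := by
    rw [← hasFDerivWithinAt_univ]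
    exact hd.comp (f := fun y : E => (t, y)) y (hasFDerivAt_prodMk_right t y).hasFDerivWithinAt
      (fun y _ => ⟨ht, mem_univ _⟩)
  have h2 : HasDerivWithinAt (fun r => F (r, y)) (fderivWithin ℝ F (I ×ˢ univ) (t, y) (1, 0)) I t :=
    hd.comp_hasDerivWithinAt (f := fun r : ℝ => (r, y)) t
      ((hasDerivWithinAt_id t I).prodMk (hasDerivWithinAt_const t I y))
      (fun y hy => ⟨hy, mem_univ _⟩)
  have h3 : HasDerivWithinAt (fun r => fderiv ℝ (f r) y)
      ((fderivWithin ℝ F (I ×ˢ univ) (t, y) (1, 0)).comp (ContinuousLinearMap.inr ℝ ℝ E)) I t := by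
    have := h2.clm_comp (hasDerivWithinAt_const t I (ContinuousLinearMap.inr ℝ ℝ E))
    refine (this.congr (fun r hr => ?_) ?_).congr_deriv (by simp)
    · exact (hasFDerivAt_slice hf hr y).fderiv
    · exact (hasFDerivAt_slice hf ht y).fderiv
  rw [h3.derivWithin (hU t ht)]
  have h4 := h1.clm_apply (hasFDerivAt_const ((1, 0) : ℝ × E) y)
  have h5 : (fun y => derivWithin (fun r => f r y) I t) = fun y => F (t, y) (1, 0) := by
    funext y
    exact (hasDerivWithinAt_slice hf ht y).derivWithin (hU t ht)
  rw [h5]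
  refine h4.congr_fderiv ?_
  ext w
  simpa using hsym (0, w) (1, 0)

end Slab

end EulerVortex

/-! ### Vector calculus and the vorticity equation -/

namespace EulerVortex

theorem convex_timeInterval (T : EReal) : Convex ℝ (timeInterval T) := by
  refine Set.OrdConnected.convex ⟨fun a ha b hb c hc => ⟨ha.1.trans hc.1, ?_⟩⟩
  exact lt_of_le_of_lt (EReal.coe_le_coe_iff.2 hc.2) hb.2

theorem isOpen_lt_time (T : EReal) : IsOpen {t : ℝ | (t : EReal) < T} :=
  isOpen_Iio.preimage continuous_coe_real_ereal

theorem timeInterval_interior_nonempty {T : EReal} (hT : 0 < T) :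
    (interior (timeInterval T)).Nonempty := by
  obtain ⟨q, h1, h2⟩ := EReal.exists_rat_btwn_of_lt hT
  refine ⟨(q : ℝ), ?_⟩
  have : IsOpen (Ioi (0 : ℝ) ∩ {t : ℝ | (t : EReal) < T}) := isOpen_Ioi.inter (isOpen_lt_time T)
  refine interior_mono (s := Ioi (0 : ℝ) ∩ {t : ℝ | (t : EReal) < T}) ?_ ?_
  · exact fun t ht => ⟨le_of_lt ht.1, ht.2⟩
  · rw [this.interior_eq]
    exact ⟨show (0 : ℝ) < q by exact_mod_cast h1, h2⟩

/-- The curl as a linear function of the gradient. -/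
noncomputable def curlCLM : (E3 →L[ℝ] E3) →L[ℝ] E3 :=
  LinearMap.toContinuousLinearMap
    { toFun := fun A => !₂[A (EuclideanSpace.single 1 1) 2 - A (EuclideanSpace.single 2 1) 1,
        A (EuclideanSpace.single 2 1) 0 - A (EuclideanSpace.single 0 1) 2,
        A (EuclideanSpace.single 0 1) 1 - A (EuclideanSpace.single 1 1) 0]
      map_add' := fun A B => by
        ext i; fin_cases i <;> simp <;> ring
      map_smul' := fun r A => by
        ext i; fin_cases i <;> simp <;> ring }

theorem curl_eq_curlCLM (F : E3 → E3) (y : E3) : curl F y = curlCLM (fderiv ℝ F y) := rfl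

/-- The divergence as a linear function of the gradient. -/
noncomputable def traceCLM : (E3 →L[ℝ] E3) →L[ℝ] ℝ :=
  LinearMap.toContinuousLinearMap
    { toFun := fun A => ∑ i : Fin 3, A (EuclideanSpace.single i 1) i
      map_add' := fun A B => by simp [Finset.sum_add_distrib]
      map_smul' := fun r A => by simp [Finset.mul_sum] }

theorem divergence_eq_traceCLM (F : E3 → E3) (y : E3) :
    divergence F y = traceCLM (fderiv ℝ F y) := rfl

theorem clm_apply_eq_sum (A : E3 →L[ℝ] E3) (v : E3) (j : Fin 3) :
    A v j = v 0 * A (EuclideanSpace.single 0 1) j + v 1 * A (EuclideanSpace.single 1 1) j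
      + v 2 * A (EuclideanSpace.single 2 1) j := by
  have hv : v = v 0 • EuclideanSpace.single (0 : Fin 3) (1 : ℝ) + v 1 • EuclideanSpace.single 1 1
      + v 2 • EuclideanSpace.single 2 1 := by
    ext i; fin_cases i <;> simp
  conv_lhs => rw [hv]
  simp

/-- For a trace free matrix `A` one has `curl (A²) = - A (curl A)`. -/
theorem curlCLM_comp_self (A : E3 →L[ℝ] E3) (hA : traceCLM A = 0) :
    curlCLM (A.comp A) = -A (curlCLM A) := by
  have hA' : A (EuclideanSpace.single 0 1) 0 + A (EuclideanSpace.single 1 1) 1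
      + A (EuclideanSpace.single 2 1) 2 = 0 := by
    rw [← hA]; simp [traceCLM, Fin.sum_univ_three]
  ext i
  rw [PiLp.neg_apply, clm_apply_eq_sum A]
  fin_cases i
  all_goals
    simp only [curlCLM, LinearMap.coe_toContinuousLinearMap', LinearMap.coe_mk, AddHom.coe_mk,
      ContinuousLinearMap.comp_apply, Fin.zero_eta, Fin.mk_one, Fin.reduceFinMk, Fin.isValue,
      PiLp.toLp_apply, Matrix.cons_val_zero, Matrix.cons_val_one, Matrix.cons_val]
    rw [clm_apply_eq_sum A (A _), clm_apply_eq_sum A (A _)]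
  -- For any A, curl(A²) + A curl A = (tr A) curl A; the coefficients are the components of curl A.
  · linear_combination (A (EuclideanSpace.single 1 1) 2 - A (EuclideanSpace.single 2 1) 1) * hA'
  · linear_combination (A (EuclideanSpace.single 2 1) 0 - A (EuclideanSpace.single 0 1) 2) * hA'
  · linear_combination (A (EuclideanSpace.single 0 1) 1 - A (EuclideanSpace.single 1 1) 0) * hA'

theorem symm_snd_fderiv {G : Type*} [NormedAddCommGroup G] [NormedSpace ℝ G] {f : E3 → G}
    (hf : ContDiff ℝ ∞ f) (y v w : E3) :
    fderiv ℝ (fderiv ℝ f) y v w = fderiv ℝ (fderiv ℝ f) y w v := by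
  have : IsSymmSndFDerivAt ℝ f y := by
    refine hf.contDiffAt.isSymmSndFDerivAt ?_
    rw [minSmoothness_of_isRCLikeNormedField]; exact WithTop.coe_le_coe.2 le_top
  exact this v w

theorem hasFDerivAt_fderiv {G : Type*} [NormedAddCommGroup G] [NormedSpace ℝ G] {f : E3 → G}
    (hf : ContDiff ℝ ∞ f) (y : E3) :
    HasFDerivAt (fderiv ℝ f) (fderiv ℝ (fderiv ℝ f) y) y :=
  ((hf.fderiv_right (m := ∞) (by simp)).differentiable (by simp) y).hasFDerivAt

/-- The divergence of a curl vanishes. -/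
theorem divergence_curl {F : E3 → E3} (hF : ContDiff ℝ ∞ F) (y : E3) :
    divergence (curl F) y = 0 := by
  have h := curlCLM.hasFDerivAt.comp y (hasFDerivAt_fderiv hF y)
  have h' : HasFDerivAt (curl F) (curlCLM.comp (fderiv ℝ (fderiv ℝ F) y)) y := h
  rw [divergence_eq_traceCLM, h'.fderiv]
  simp only [traceCLM, curlCLM, LinearMap.coe_toContinuousLinearMap', LinearMap.coe_mk,
      AddHom.coe_mk, ContinuousLinearMap.comp_apply, Fin.sum_univ_three, Fin.isValue,
      Matrix.cons_val_zero, Matrix.cons_val_one, Matrix.cons_val]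
  rw [symm_snd_fderiv hF y (EuclideanSpace.single 1 1) (EuclideanSpace.single 0 1),
    symm_snd_fderiv hF y (EuclideanSpace.single 2 1) (EuclideanSpace.single 0 1),
    symm_snd_fderiv hF y (EuclideanSpace.single 2 1) (EuclideanSpace.single 1 1)]
  ring

/-- The derivative of a gradient is the Hessian, whose symmetry annihilates the curl; this removes
the pressure. -/
theorem curlCLM_fderiv_gradient {q : E3 → ℝ} (hq : ContDiff ℝ ∞ q) (y : E3) :
    ∃ H : E3 →L[ℝ] E3, HasFDerivAt (gradient q) H y ∧ curlCLM H = 0 := by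
  set J := (InnerProductSpace.toDual ℝ E3).symm with hJ
  have h := (J.toContinuousLinearEquiv.toContinuousLinearMap.hasFDerivAt (x := fderiv ℝ q y)).comp y
    (hasFDerivAt_fderiv hq y)
  refine ⟨_, h, ?_⟩
  have key : ∀ (i j : Fin 3),
      (J (fderiv ℝ (fderiv ℝ q) y (EuclideanSpace.single i 1))) j
        = fderiv ℝ (fderiv ℝ q) y (EuclideanSpace.single i 1) (EuclideanSpace.single j 1) := by
    intro i j
    rw [← InnerProductSpace.toDual_symm_apply, EuclideanSpace.inner_single_right]
    simp [hJ]
  ext i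
  fin_cases i
  all_goals
    simp only [curlCLM, LinearMap.coe_toContinuousLinearMap', LinearMap.coe_mk, AddHom.coe_mk,
      ContinuousLinearMap.comp_apply, Fin.zero_eta, Fin.mk_one, Fin.reduceFinMk, Fin.isValue,
      PiLp.toLp_apply, Matrix.cons_val_zero, Matrix.cons_val_one, Matrix.cons_val,
      PiLp.zero_apply]
    refine sub_eq_zero.2 ?_
    refine (key _ _).trans ?_
    refine (symm_snd_fderiv hq y _ _).trans (key _ _).symm

variable {T : EReal} {u : ℝ → E3 → E3} {p : ℝ → E3 → ℝ}

theorem time_pos_of_le_of_lt {T₀ : ℝ} (h0 : 0 ≤ T₀) (h1 : (T₀ : EReal) < T) : 0 < T :=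
  lt_of_le_of_lt (by exact_mod_cast h0) h1

theorem uniqueDiffOn_timeInterval (hT : 0 < T) : UniqueDiffOn ℝ (timeInterval T) :=
  uniqueDiffOn_convex (convex_timeInterval T) (timeInterval_interior_nonempty hT)

theorem IsEulerSolution.contDiff_velocity (h : IsEulerSolution T u p) {t : ℝ}
    (ht : t ∈ timeInterval T) : ContDiff ℝ ∞ (u t) :=
  contDiff_slice h.smooth_velocity ht

theorem IsEulerSolution.contDiffOn_vorticity (h : IsEulerSolution T u p) (hT : 0 < T) :
    ContDiffOn ℝ ∞ (fun z : ℝ × E3 => vorticity u z.1 z.2) (timeInterval T ×ˢ univ) :=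
  curlCLM.contDiff.comp_contDiffOn
    (contDiffOn_fderiv_slice (uniqueDiffOn_timeInterval hT) h.smooth_velocity)

theorem IsEulerSolution.contDiff_vorticity (h : IsEulerSolution T u p) {t : ℝ}
    (ht : t ∈ timeInterval T) : ContDiff ℝ ∞ (vorticity u t) :=
  curlCLM.contDiff.comp ((h.contDiff_velocity ht).fderiv_right (m := ∞) (by simp))

/-- The vorticity equation along a particle trajectory. -/
theorem IsEulerSolution.vorticity_along (h : IsEulerSolution T u p) (hT : 0 < T) {T₀ : ℝ}
    (h0 : 0 ≤ T₀) {t : ℝ} (ht0 : T₀ ≤ t) (htT : (t : EReal) < T) {y : ℝ → E3}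
    (hy : HasDerivWithinAt y (u t (y t)) (Ici T₀) t) :
    HasDerivWithinAt (fun r => vorticity u r (y r))
      (fderiv ℝ (u t) (y t) (vorticity u t (y t))) (Ici T₀) t := by
  have ht : t ∈ timeInterval T := ⟨h0.trans ht0, htT⟩
  have hI := uniqueDiffOn_timeInterval hT
  have hu := h.contDiff_velocity ht
  set K : Set ℝ := Ici T₀ ∩ {t : ℝ | (t : EReal) < T} with hK
  have hKI : K ⊆ timeInterval T := fun r hr => ⟨h0.trans hr.1, hr.2⟩
  -- The gradient A = ∇u is differentiated along the trajectory. The space derivative of the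
  -- momentum equation gives dA/dt = -A² - Hess p, the convective terms cancelling by symmetry of
  -- the second derivative (`h6`). Taking the curl with tr A = 0 leaves Aω.
  have h1 := hasDerivWithinAt_along (f := fun r => fderiv ℝ (u r)) (contDiffOn_fderiv_slice hI h.smooth_velocity) ht (hI t ht) hKI
    (hy.mono (inter_subset_left (t := {t : ℝ | (t : EReal) < T})))
  have h2 := hasFDerivAt_derivWithin_slice (convex_timeInterval T)
    (timeInterval_interior_nonempty hT) h.smooth_velocity ht (y t)
  obtain ⟨H, hH, hH0⟩ := curlCLM_fderiv_gradient (contDiff_slice h.smooth_pressure ht) (y t)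
  have h3 : HasFDerivAt (fun y => -(fderiv ℝ (u t) y (u t y)) - gradient (p t) y)
      (-((fderiv ℝ (u t) (y t)).comp (fderiv ℝ (u t) (y t))
        + (fderiv ℝ (fderiv ℝ (u t)) (y t)).flip (u t (y t))) - H) (y t) :=
    ((hasFDerivAt_fderiv hu (y t)).clm_apply
      (hu.differentiable (by simp) (y t)).hasFDerivAt).neg.sub hH
  have h4 : (fun y => derivWithin (fun r => u r y) (timeInterval T) t)
      = fun y => -(fderiv ℝ (u t) y (u t y)) - gradient (p t) y := by
    funext y
    have := h.momentum t ht y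
    rw [add_assoc] at this
    rw [eq_neg_of_add_eq_zero_left this]
    abel
  rw [h4] at h2
  have h5 := h2.unique h3
  rw [h5] at h1
  have h6 : fderiv ℝ (fderiv ℝ (u t)) (y t) (u t (y t))
      = (fderiv ℝ (fderiv ℝ (u t)) (y t)).flip (u t (y t)) := by
    ext1 w
    exact symm_snd_fderiv hu _ _ _
  rw [h6] at h1
  have h7 := curlCLM.hasFDerivAt.comp_hasDerivWithinAt t h1
  have h8 : HasDerivWithinAt (fun r => vorticity u r (y r))
      (fderiv ℝ (u t) (y t) (vorticity u t (y t))) K t := by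
    refine HasDerivWithinAt.congr_deriv h7 ?_
    have h9 := curlCLM_comp_self (fderiv ℝ (u t) (y t)) (h.incompressible t ht (y t))
    rw [map_add, map_sub, map_neg, map_add, hH0, h9]
    simp only [vorticity, curl_eq_curlCLM]
    abel
  exact (hasDerivWithinAt_inter ((isOpen_lt_time T).mem_nhds htT)).1 h8

end EulerVortex

/-! ### Material vortex lines and Helmholtz' theorem -/

namespace EulerVortex

theorem gronwallBound_le_of_one_le {δ K ε x : ℝ} (hK : 1 ≤ K) (hε : 0 ≤ ε) :
    gronwallBound δ K ε x ≤ (δ + ε) * Real.exp (K * x) := by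
  rw [gronwallBound_of_K_ne_0 (by linarith)]
  have h1 : ε / K ≤ ε := div_le_self hε hK
  have h2 : 0 ≤ ε / K := by positivity
  have h3 := Real.exp_pos (K * x)
  nlinarith

/-- The times `T₀ ≤ t < T`. -/
def timesFrom (T : EReal) (T₀ : ℝ) : Set ℝ := {t : ℝ | T₀ ≤ t ∧ (t : EReal) < T}

variable {T : EReal} {u : ℝ → E3 → E3} {p : ℝ → E3 → ℝ} {T₀ : ℝ} {J : Set ℝ} {Y : ℝ → ℝ → E3}

theorem Icc_subset_timesFrom {t₁ : ℝ} (ht₁ : (t₁ : EReal) < T) :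
    Icc T₀ t₁ ⊆ timesFrom T T₀ :=
  fun _ ht => ⟨ht.1, lt_of_le_of_lt (EReal.coe_le_coe_iff.2 ht.2) ht₁⟩

theorem timesFrom_subset (h0 : 0 ≤ T₀) : timesFrom T T₀ ⊆ timeInterval T :=
  fun _ ht => ⟨h0.trans ht.1, ht.2⟩

theorem exists_time_between {t : ℝ} (ht : t ∈ timesFrom T T₀) :
    ∃ t₁, t < t₁ ∧ (t₁ : EReal) < T := by
  obtain ⟨q, h1, h2⟩ := EReal.exists_rat_btwn_of_lt ht.2
  exact ⟨q, by exact_mod_cast h1, h2⟩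

/-- Bounds for the first and second space derivatives of the velocity. -/
theorem IsEulerSolution.exists_bound (h : IsEulerSolution T u p) (hT : 0 < T) (h0 : 0 ≤ T₀)
    {t₁ : ℝ} (ht₁ : (t₁ : EReal) < T) (R : ℝ) :
    ∃ K : ℝ, 1 ≤ K ∧ ∀ t ∈ Icc T₀ t₁, ∀ z ∈ Metric.closedBall (0 : E3) R,
      ‖fderiv ℝ (u t) z‖ ≤ K ∧ ‖fderiv ℝ (fderiv ℝ (u t)) z‖ ≤ K := by
  have hI := uniqueDiffOn_timeInterval hT
  have c1 := contDiffOn_fderiv_slice hI h.smooth_velocity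
  have c2 := contDiffOn_fderiv_slice (f := fun r => fderiv ℝ (u r)) hI c1
  have hcomp : IsCompact (Icc T₀ t₁ ×ˢ Metric.closedBall (0 : E3) R) :=
    isCompact_Icc.prod (isCompact_closedBall _ _)
  have hsub : Icc T₀ t₁ ×ˢ Metric.closedBall (0 : E3) R ⊆ timeInterval T ×ˢ univ :=
    prod_mono ((Icc_subset_timesFrom ht₁).trans (timesFrom_subset h0)) (subset_univ _)
  obtain ⟨K1, hK1⟩ := hcomp.exists_bound_of_continuousOn (c1.continuousOn.mono hsub)
  obtain ⟨K2, hK2⟩ := hcomp.exists_bound_of_continuousOn (c2.continuousOn.mono hsub)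
  refine ⟨max 1 (max K1 K2), le_max_left _ _, fun t ht z hz => ⟨?_, ?_⟩⟩
  · exact (hK1 (t, z) ⟨ht, hz⟩).trans ((le_max_left _ _).trans (le_max_right _ _))
  · exact (hK2 (t, z) ⟨ht, hz⟩).trans ((le_max_right _ _).trans (le_max_right _ _))

theorem IsMaterialVortexLine.hasDerivWithinAt_Ici (hY : IsMaterialVortexLine T u T₀ J Y) {β : ℝ}
    (hβ : β ∈ J) {t : ℝ} (ht : t ∈ timesFrom T T₀) :
    HasDerivWithinAt (fun r => Y r β) (u t (Y t β)) (Ici t) t :=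
  (hY.trajectory β hβ t ht.1 ht.2).mono (Ici_subset_Ici.2 ht.1)

theorem IsMaterialVortexLine.continuousOn_time (hY : IsMaterialVortexLine T u T₀ J Y) {β : ℝ}
    (hβ : β ∈ J) : ContinuousOn (fun r => Y r β) (timesFrom T T₀) := fun t ht =>
  ((hY.trajectory β hβ t ht.1 ht.2).continuousWithinAt).mono (fun _ hr => hr.1)

/-- The flow is locally Lipschitz on a material line, and its deviation from the linearized flow
is locally quadratic. -/
theorem IsMaterialVortexLine.exists_flow_bound (h : IsEulerSolution T u p) (hT : 0 < T)
    (h0 : 0 ≤ T₀) (hY : IsMaterialVortexLine T u T₀ J Y) {β : ℝ} (hβ : β ∈ J)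
    {t₁ : ℝ} (ht₁ : (t₁ : EReal) < T) :
    ∃ C δ : ℝ, 0 < δ ∧ 0 < C ∧ ∀ β' ∈ J, ∀ ε : ℝ, 0 < ε → ε ≤ δ → ‖Y T₀ β' - Y T₀ β‖ ≤ ε →
      ∀ t ∈ Icc T₀ t₁, ‖Y t β' - Y t β‖ ≤ C * ε ∧
        ∀ r : ℝ, ‖Y t β' - Y t β - r • vorticity u t (Y t β)‖ ≤
          C * (‖Y T₀ β' - Y T₀ β - r • vorticity u T₀ (Y T₀ β)‖ + C * ε ^ 2) := by
  have hsub := Icc_subset_timesFrom (T₀ := T₀) ht₁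
  obtain ⟨R, hR⟩ := isCompact_Icc.exists_bound_of_continuousOn
    ((hY.continuousOn_time hβ).mono hsub)
  obtain ⟨K, hK1, hK⟩ := h.exists_bound hT h0 ht₁ (R + 1)
  -- The rate K + 1 instead of K provides the strict inequality needed in the barrier argument for
  -- `htube`.
  set e1 := Real.exp ((K + 1) * (t₁ - T₀)) with he1
  have he1p : 0 < e1 := Real.exp_pos _
  have hexp : ∀ t ∈ Icc T₀ t₁, Real.exp ((K + 1) * (t - T₀)) ≤ e1 := fun t ht =>
    Real.exp_le_exp.2 (mul_le_mul_of_nonneg_left (by linarith [ht.2]) (by linarith))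
  have hexp' : ∀ t ∈ Icc T₀ t₁, Real.exp (K * (t - T₀)) ≤ e1 := fun t ht =>
    Real.exp_le_exp.2 (by nlinarith [ht.1, ht.2])
  have hlip : ∀ t ∈ Icc T₀ t₁, ∀ z, ‖z - Y t β‖ ≤ 1 →
      ‖u t z - u t (Y t β)‖ ≤ K * ‖z - Y t β‖ ∧
      ‖u t z - u t (Y t β) - fderiv ℝ (u t) (Y t β) (z - Y t β)‖ ≤ K * ‖z - Y t β‖ ^ 2 := by
    intro t ht z hz
    have hu := h.contDiff_velocity (timesFrom_subset h0 (hsub ht))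
    have hy0 : Y t β ∈ Metric.closedBall (0 : E3) (R + 1) := by
      rw [mem_closedBall_zero_iff]; linarith [hR t ht]
    have hz0 : z ∈ Metric.closedBall (0 : E3) (R + 1) := by
      rw [mem_closedBall_zero_iff]
      have := norm_add_le (z - Y t β) (Y t β)
      rw [sub_add_cancel] at this
      linarith [hR t ht]
    have hconv := convex_closedBall (0 : E3) (R + 1)
    refine ⟨hconv.norm_image_sub_le_of_norm_fderiv_le
      (fun w _ => hu.differentiable (by simp) w) (fun w hw => (hK t ht w hw).1) hy0 hz0, ?_⟩
    have hA : ∀ w ∈ Metric.closedBall (0 : E3) (R + 1),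
        ‖fderiv ℝ (u t) w - fderiv ℝ (u t) (Y t β)‖ ≤ K * ‖w - Y t β‖ := fun w hw =>
      hconv.norm_image_sub_le_of_norm_fderiv_le
        (fun w _ => (hasFDerivAt_fderiv hu w).differentiableAt) (fun w hw => (hK t ht w hw).2)
        hy0 hw
    -- On the part of the ball within distance |z - Y t β| of Y t β, the gradient differs from its
    -- value at Y t β by at most K|z - Y t β|; the mean value inequality there gives the quadratic
    -- remainder.
    have hconv2 := hconv.inter (convex_closedBall (Y t β) ‖z - Y t β‖)
    have := hconv2.norm_image_sub_le_of_norm_hasFDerivWithin_le' (f := u t)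
      (f' := fderiv ℝ (u t)) (φ := fderiv ℝ (u t) (Y t β)) (C := K * ‖z - Y t β‖)
      (fun w _ => (hu.differentiable (by simp) w).hasFDerivAt.hasFDerivWithinAt)
      (fun w hw => (hA w hw.1).trans
        (mul_le_mul_of_nonneg_left (by simpa [dist_eq_norm] using hw.2) (by linarith)))
      (x := Y t β) (y := z) ⟨hy0, by simp⟩ ⟨hz0, by simp [dist_eq_norm]⟩
    rw [sq, ← mul_assoc]
    exact this
  have hKC : 0 < max e1 (K * e1 ^ 2) := lt_max_of_lt_left he1p
  -- The choice δ = 1/e1 keeps the neighbouring trajectory within distance 1, hence in the ball of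
  -- radius R + 1 where K is valid. The constant has to dominate both the growth factor e1 and the
  -- coefficient K e1² of the quadratic forcing.
  refine ⟨max e1 (K * e1 ^ 2), 1 / e1, by positivity, hKC, ?_⟩
  intro β' hβ' ε hε hεδ hεβ
  have hεe : ε * e1 ≤ 1 := by
    rw [le_div_iff₀ he1p] at hεδ; exact hεδ
  have hdiff : ∀ t ∈ timesFrom T T₀, HasDerivWithinAt (fun r => Y r β' - Y r β)
      (u t (Y t β') - u t (Y t β)) (Ici t) t := fun t ht =>
    (hY.hasDerivWithinAt_Ici hβ' ht).sub (hY.hasDerivWithinAt_Ici hβ ht)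
  have hcont : ContinuousOn (fun r => Y r β' - Y r β) (Icc T₀ t₁) :=
    ((hY.continuousOn_time hβ').sub (hY.continuousOn_time hβ)).mono hsub
  -- At a first contact with the barrier the distance is at most 1, so its growth rate is at most K
  -- times the distance, strictly below that of the barrier.
  have htube : ∀ t ∈ Icc T₀ t₁, ‖Y t β' - Y t β‖ ≤ ε * Real.exp ((K + 1) * (t - T₀)) := by
    refine image_norm_le_of_norm_deriv_right_lt_deriv_boundary hcont
      (fun t ht => hdiff t (hsub (Ico_subset_Icc_self ht)))
      (B' := fun t => (K + 1) * (ε * Real.exp ((K + 1) * (t - T₀)))) (by simpa using hεβ) ?_ ?_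
    · intro t
      have := (((hasDerivAt_id t).sub_const T₀).const_mul (K + 1)).exp.const_mul ε
      exact this.congr_deriv (by simp; ring)
    · intro t ht heq
      have ht' := Ico_subset_Icc_self ht
      have hpos : 0 < ε * Real.exp ((K + 1) * (t - T₀)) := by positivity
      have hle1 : ‖Y t β' - Y t β‖ ≤ 1 :=
        heq.le.trans ((mul_le_mul_of_nonneg_left (hexp t ht') hε.le).trans hεe)
      have := (hlip t ht' (Y t β') hle1).1
      rw [heq] at this
      linarith
  have htube' : ∀ t ∈ Icc T₀ t₁, ‖Y t β' - Y t β‖ ≤ e1 * ε := fun t ht =>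
    (htube t ht).trans (by rw [mul_comm]; exact mul_le_mul_of_nonneg_right (hexp t ht) hε.le)
  intro t ht
  refine ⟨(htube' t ht).trans (mul_le_mul_of_nonneg_right (le_max_left _ _) hε.le), fun r => ?_⟩
  have hvder : ∀ t ∈ timesFrom T T₀, HasDerivWithinAt (fun s => vorticity u s (Y s β))
      (fderiv ℝ (u t) (Y t β) (vorticity u t (Y t β))) (Ici T₀) t := fun t ht =>
    h.vorticity_along hT h0 ht.1 ht.2 (hY.trajectory β hβ t ht.1 ht.2)
  -- Any multiple r ω along the trajectory solves the linearized flow equation, so the deviation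
  -- from it obeys a linear inequality forced only by the Taylor remainder of u.
  have hgr := norm_le_gronwallBound_of_norm_deriv_right_le (K := K) (ε := K * (e1 * ε) ^ 2)
    (f := fun t => Y t β' - Y t β - r • vorticity u t (Y t β))
    (f' := fun t => u t (Y t β') - u t (Y t β)
      - r • fderiv ℝ (u t) (Y t β) (vorticity u t (Y t β)))
    (a := T₀) (b := t₁)
    (hcont.sub (ContinuousOn.const_smul
      (fun s hs => ((hvder s (hsub hs)).continuousWithinAt).mono (fun _ hr => hr.1)) r))
    (fun s hs => (hdiff s (hsub (Ico_subset_Icc_self hs))).sub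
      (((hvder s (hsub (Ico_subset_Icc_self hs))).mono (Ici_subset_Ici.2 hs.1)).const_smul r))
    le_rfl ?_ t ht
  · refine hgr.trans ((gronwallBound_le_of_one_le hK1 (by positivity)).trans ?_)
    rw [mul_comm]
    refine mul_le_mul ((hexp' t ht).trans (le_max_left _ _)) ?_ (by positivity) hKC.le
    refine add_le_add le_rfl ?_
    rw [mul_pow, ← mul_assoc]
    exact mul_le_mul_of_nonneg_right (le_max_right _ _) (by positivity)
  · intro s hs
    have hs' := Ico_subset_Icc_self hs
    have hd1 : ‖Y s β' - Y s β‖ ≤ 1 := (htube' s hs').trans (by linarith)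
    have hA := (hlip s hs' (Y s β') hd1).2
    have hB := (hK s hs' (Y s β)
      (by rw [mem_closedBall_zero_iff]; linarith [hR s hs'])).1
    have hC := (fderiv ℝ (u s) (Y s β)).le_of_opNorm_le hB
      (Y s β' - Y s β - r • vorticity u s (Y s β))
    have heq : u s (Y s β') - u s (Y s β) - r • fderiv ℝ (u s) (Y s β) (vorticity u s (Y s β))
        = (u s (Y s β') - u s (Y s β) - fderiv ℝ (u s) (Y s β) (Y s β' - Y s β))
          + fderiv ℝ (u s) (Y s β) (Y s β' - Y s β - r • vorticity u s (Y s β)) := by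
      rw [map_sub _ (Y s β' - Y s β), map_smul]; abel
    rw [heq]
    refine (norm_add_le _ _).trans ?_
    rw [add_comm]
    refine add_le_add hC (hA.trans (mul_le_mul_of_nonneg_left ?_ (by linarith)))
    exact pow_le_pow_left₀ (norm_nonneg _) (htube' s hs') 2

/-- The stretching factor relating the initial arclength to the vorticity. -/
noncomputable def lineDensity (u : ℝ → E3 → E3) (T₀ : ℝ) (Y : ℝ → ℝ → E3) (β : ℝ) : ℝ :=
  ‖vorticity u T₀ (Y T₀ β)‖⁻¹

theorem IsMaterialVortexLine.lineDensity_pos (hY : IsMaterialVortexLine T u T₀ J Y) {β : ℝ}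
    (hβ : β ∈ J) : 0 < lineDensity u T₀ Y β :=
  inv_pos.2 (norm_pos_iff.2 (hY.nonvanishing β hβ))

theorem IsMaterialVortexLine.continuousOn_lineDensity (h : IsEulerSolution T u p) (h0 : 0 ≤ T₀)
    (hT₀ : (T₀ : EReal) < T) (hY : IsMaterialVortexLine T u T₀ J Y) :
    ContinuousOn (lineDensity u T₀ Y) J := by
  refine ContinuousOn.inv₀ ?_ (fun β hβ => norm_ne_zero_iff.2 (hY.nonvanishing β hβ))
  refine (h.contDiff_vorticity ⟨h0, hT₀⟩).continuous.norm.comp_continuousOn ?_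
  exact fun β hβ => (hY.initial_line β hβ).continuousWithinAt

/-- Helmholtz' theorem: the image of a vortex line under the flow is a vortex line. -/
theorem IsMaterialVortexLine.hasDerivWithinAt_label (h : IsEulerSolution T u p) (hT : 0 < T)
    (h0 : 0 ≤ T₀) (hY : IsMaterialVortexLine T u T₀ J Y) {β : ℝ} (hβ : β ∈ J)
    {t : ℝ} (ht : t ∈ timesFrom T T₀) :
    HasDerivWithinAt (Y t) (lineDensity u T₀ Y β • vorticity u t (Y t β)) J β := by
  obtain ⟨C, δ, hδ, hC, hflow⟩ := hY.exists_flow_bound h hT h0 hβ ht.2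
  have hini := hY.initial_line β hβ
  obtain ⟨C1, hC1, hO⟩ := hini.differentiableWithinAt.isBigO_sub.exists_pos
  rw [Asymptotics.isBigOWith_iff] at hO
  have hlit := hasDerivWithinAt_iff_isLittleO.1 hini
  rw [hasDerivWithinAt_iff_isLittleO, Asymptotics.isLittleO_iff]
  intro η hη
  -- The error η|β' - β| is split in two halves: the factor C times the initial deviation, and the
  -- quadratic term C²C1²|β' - β|².
  have hl := (Asymptotics.isLittleO_iff.1 hlit) (c := η / (2 * C)) (by positivity)
  have hnear : ∀ ρ : ℝ, 0 < ρ → ∀ᶠ β' in nhdsWithin β J, ‖β' - β‖ ≤ ρ := by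
    intro ρ hρ
    filter_upwards [mem_nhdsWithin_of_mem_nhds (Metric.closedBall_mem_nhds β hρ)] with b hb
    simpa [dist_eq_norm] using hb
  filter_upwards [hl, hO, hnear (δ / C1) (by positivity),
    hnear (η / (2 * C ^ 2 * C1 ^ 2)) (by positivity), self_mem_nhdsWithin] with β' a1 a2 a3 a4 hβ'
  rcases eq_or_ne β' β with rfl | hne
  · simp
  have hd : 0 < ‖β' - β‖ := norm_pos_iff.2 (sub_ne_zero.2 hne)
  -- With r = (β' - β)/|ω₀| the initial vector r ω₀ is (β' - β)ξ₀, so the deviation at T₀ is the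
  -- first-order remainder of the arclength parametrization. The flow bound carries its smallness to
  -- time t.
  have h1 := (hflow β' hβ' (C1 * ‖β' - β‖) (by positivity)
    (by rw [le_div_iff₀ hC1] at a3; linarith) a2 t ⟨ht.1, le_rfl⟩).2
      ((β' - β) * lineDensity u T₀ Y β)
  rw [mul_smul, mul_smul] at h1
  have h2 : lineDensity u T₀ Y β • vorticity u T₀ (Y T₀ β) = xi u T₀ (Y T₀ β) := rfl
  rw [h2] at h1
  refine h1.trans ?_
  have h3 : C * (C * (C1 * ‖β' - β‖) ^ 2) ≤ η / 2 * ‖β' - β‖ := by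
    rw [le_div_iff₀ (by positivity)] at a4
    nlinarith
  have h4 : C * (η / (2 * C) * ‖β' - β‖) = η / 2 * ‖β' - β‖ := by field_simp
  have h5 := mul_le_mul_of_nonneg_left a1 hC.le
  rw [h4] at h5
  rw [mul_add]
  linarith

/-- Continuity in each variable alone does not suffice; the Lipschitz bound of the flow in the label
is uniform in time up to some t₁ > t. -/
theorem IsMaterialVortexLine.continuousOn_uncurry (h : IsEulerSolution T u p) (hT : 0 < T)
    (h0 : 0 ≤ T₀) (hY : IsMaterialVortexLine T u T₀ J Y) :
    ContinuousOn (fun z : ℝ × ℝ => Y z.1 z.2) (timesFrom T T₀ ×ˢ J) := by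
  rintro ⟨t, β⟩ ⟨ht, hβ⟩
  obtain ⟨t₁, htt₁, ht₁⟩ := exists_time_between ht
  obtain ⟨C, δ, hδ, hC, hflow⟩ := hY.exists_flow_bound h hT h0 hβ ht₁
  rw [Metric.continuousWithinAt_iff']
  intro η hη
  have hcY : ContinuousWithinAt (Y T₀) J β := (hY.initial_line β hβ).continuousWithinAt
  have htend2 : Filter.Tendsto Prod.snd (nhdsWithin (t, β) (timesFrom T T₀ ×ˢ J))
      (nhdsWithin β J) := by
    rw [nhdsWithin_prod_eq]; exact Filter.tendsto_snd
  have htend1 : Filter.Tendsto Prod.fst (nhdsWithin (t, β) (timesFrom T T₀ ×ˢ J))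
      (nhdsWithin t (timesFrom T T₀)) := by
    rw [nhdsWithin_prod_eq]; exact Filter.tendsto_fst
  set ε := min δ (η / (4 * C)) with hε
  have hεp : 0 < ε := lt_min hδ (by positivity)
  have e1 := htend2.eventually (Metric.continuousWithinAt_iff'.1 hcY ε hεp)
  have e2 := htend1.eventually
    (Metric.continuousWithinAt_iff'.1 (hY.continuousOn_time hβ t ht) (η / 2) (by positivity))
  have e3 := htend1.eventually (mem_nhdsWithin_of_mem_nhds (Iio_mem_nhds htt₁))
  filter_upwards [e1, e2, e3, self_mem_nhdsWithin] with z a1 a2 a3 hz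
  rw [dist_eq_norm] at a1
  have b1 := (hflow z.2 hz.2 ε hεp (min_le_left _ _) a1.le z.1 ⟨hz.1.1, le_of_lt a3⟩).1
  have b2 : C * ε ≤ η / 4 := by
    have := mul_le_mul_of_nonneg_left (min_le_right δ (η / (4 * C))) hC.le
    refine this.trans (le_of_eq ?_)
    field_simp
  calc dist (Y z.1 z.2) (Y t β) ≤ dist (Y z.1 z.2) (Y z.1 β) + dist (Y z.1 β) (Y t β) :=
        dist_triangle _ _ _
    _ < η := by rw [dist_eq_norm (Y z.1 z.2)]; linarith

end EulerVortex

/-! ### Implicit functions and parametric integrals in one-sided form -/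

namespace EulerVortex

section Calculus

variable {E : Type*} [NormedAddCommGroup E]

/-- A function of two real variables with one continuous partial derivative is differentiable. -/
theorem hasFDerivWithinAt_of_partials [NormedSpace ℝ E] {Φ Φt : ℝ → ℝ → E} {I J : Set ℝ}
    (hI : Convex ℝ I) {t₀ b₀ : ℝ} (ht₀ : t₀ ∈ I) {w : E}
    (h1 : ∀ t ∈ I, ∀ b ∈ J, HasDerivWithinAt (fun r => Φ r b) (Φt t b) I t)
    (hc : ContinuousWithinAt (fun z : ℝ × ℝ => Φt z.1 z.2) (I ×ˢ J) (t₀, b₀))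
    (h2 : HasDerivWithinAt (Φ t₀) w J b₀) :
    HasFDerivWithinAt (fun z : ℝ × ℝ => Φ z.1 z.2)
      ((ContinuousLinearMap.fst ℝ ℝ ℝ).smulRight (Φt t₀ b₀)
        + (ContinuousLinearMap.snd ℝ ℝ ℝ).smulRight w) (I ×ˢ J) (t₀, b₀) := by
  rw [hasFDerivWithinAt_iff_isLittleO, Asymptotics.isLittleO_iff]
  intro ε hε
  obtain ⟨δ, hδ, hd⟩ := Metric.continuousWithinAt_iff.1 hc (ε / 2) (by positivity)
  have hl := (Asymptotics.isLittleO_iff.1 (hasDerivWithinAt_iff_isLittleO.1 h2))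
    (c := ε / 2) (by positivity)
  have htend2 : Filter.Tendsto Prod.snd (nhdsWithin (t₀, b₀) (I ×ˢ J)) (nhdsWithin b₀ J) := by
    rw [nhdsWithin_prod_eq]; exact Filter.tendsto_snd
  filter_upwards [htend2.eventually hl, self_mem_nhdsWithin,
    mem_nhdsWithin_of_mem_nhds (Metric.ball_mem_nhds (t₀, b₀) hδ)] with z a1 hz hzb
  have hzb' : dist z.1 t₀ < δ ∧ dist z.2 b₀ < δ := by
    simpa [Prod.dist_eq] using hzb
  have hconv : Convex ℝ (I ∩ Metric.ball t₀ δ) := hI.inter (convex_ball t₀ δ)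
  -- The increment is split into a move in t at fixed second variable, handled by the mean value
  -- inequality and continuity of `Φt`, and a move in the second variable at t₀, which is `h2`.
  have hmv := hconv.norm_image_sub_le_of_norm_hasDerivWithin_le
    (f := fun r => Φ r z.2 - r • Φt t₀ b₀) (f' := fun r => Φt r z.2 - Φt t₀ b₀) (C := ε / 2)
    (x := t₀) (y := z.1)
    (fun r hr => by
      have := ((h1 r hr.1 z.2 hz.2).mono (inter_subset_left (t := Metric.ball t₀ δ))).sub
        ((hasDerivWithinAt_id r (I ∩ Metric.ball t₀ δ)).smul_const (Φt t₀ b₀))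
      exact this.congr_deriv (by simp))
    (fun r hr => by
      have := hd (x := (r, z.2)) ⟨hr.1, hz.2⟩ (by simpa [Prod.dist_eq] using ⟨hr.2, hzb'.2⟩)
      rw [dist_eq_norm] at this
      exact this.le)
    ⟨ht₀, Metric.mem_ball_self hδ⟩ ⟨hz.1, hzb'.1⟩
  have heq : Φ z.1 z.2 - Φ t₀ b₀ - ((ContinuousLinearMap.fst ℝ ℝ ℝ).smulRight (Φt t₀ b₀)
        + (ContinuousLinearMap.snd ℝ ℝ ℝ).smulRight w) (z - (t₀, b₀))
      = (Φ z.1 z.2 - z.1 • Φt t₀ b₀ - (Φ t₀ z.2 - t₀ • Φt t₀ b₀))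
        + (Φ t₀ z.2 - Φ t₀ b₀ - (z.2 - b₀) • w) := by
    simp [sub_smul]; abel
  rw [heq]
  have n1 : ‖z.1 - t₀‖ ≤ ‖z - (t₀, b₀)‖ := norm_fst_le (z - (t₀, b₀))
  have n2 : ‖z.2 - b₀‖ ≤ ‖z - (t₀, b₀)‖ := norm_snd_le (z - (t₀, b₀))
  refine (norm_add_le _ _).trans ?_
  nlinarith

/-- Differentiation of a continuous implicit function of one variable. -/
theorem hasDerivWithinAt_implicit [InnerProductSpace ℝ E] {Φ : ℝ × ℝ → E} {S : Set (ℝ × ℝ)}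
    {t₀ : ℝ} {g : ℝ → ℝ} {N : Set ℝ} {a w x' : E} (hw : w ≠ 0)
    (hΦ : HasFDerivWithinAt Φ ((ContinuousLinearMap.fst ℝ ℝ ℝ).smulRight a
        + (ContinuousLinearMap.snd ℝ ℝ ℝ).smulRight w) S (t₀, g t₀))
    (hg : ContinuousWithinAt g N t₀) (hS : ∀ t ∈ N, (t, g t) ∈ S)
    (hx : HasDerivWithinAt (fun t => Φ (t, g t)) x' N t₀) :
    HasDerivWithinAt g (inner ℝ w (x' - a) / ‖w‖ ^ 2) N t₀ := by
  have hw0 : 0 < ‖w‖ := norm_pos_iff.2 hw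
  have htend : Filter.Tendsto (fun t => (t, g t)) (nhdsWithin t₀ N) (nhdsWithin (t₀, g t₀) S) :=
    tendsto_nhdsWithin_iff.2 ⟨(continuousWithinAt_id.prodMk hg), by
      filter_upwards [self_mem_nhdsWithin] with t ht using hS t ht⟩
  have hr := (hasFDerivWithinAt_iff_isLittleO.1 hΦ).comp_tendsto htend
  have hq := hasDerivWithinAt_iff_isLittleO.1 hx
  -- The increment of Φ along the graph of g is expanded both by `hx` and by `hΦ`; pairing the
  -- difference of the two remainders with w isolates the increment of g.
  have hdiff : ∀ t, inner ℝ w ((Φ (t, g t) - Φ (t₀, g t₀) - (t - t₀) • x')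
      - (Φ (t, g t) - Φ (t₀, g t₀) - ((ContinuousLinearMap.fst ℝ ℝ ℝ).smulRight a
        + (ContinuousLinearMap.snd ℝ ℝ ℝ).smulRight w) ((t, g t) - (t₀, g t₀))))
      = ‖w‖ ^ 2 * (g t - g t₀) - (t - t₀) * inner ℝ w (x' - a) := by
    intro t
    rw [sub_sub_sub_cancel_left]
    simp only [Prod.mk_sub_mk, add_apply,
      ContinuousLinearMap.smulRight_apply, ContinuousLinearMap.coe_fst',
      ContinuousLinearMap.coe_snd', inner_sub_right, inner_add_right, inner_smul_right,
      real_inner_self_eq_norm_sq]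
    ring
  have hest : ∀ ε : ℝ, 0 < ε → ∀ᶠ t in nhdsWithin t₀ N,
      |‖w‖ ^ 2 * (g t - g t₀) - (t - t₀) * inner ℝ w (x' - a)|
        ≤ ‖w‖ * (2 * ε * |t - t₀| + ε * |g t - g t₀|) := by
    intro ε hε
    filter_upwards [Asymptotics.isLittleO_iff.1 hr hε, Asymptotics.isLittleO_iff.1 hq hε]
      with t b1 b2
    rw [← hdiff t]
    refine (abs_real_inner_le_norm _ _).trans (mul_le_mul_of_nonneg_left ?_ hw0.le)
    refine (norm_sub_le _ _).trans ?_
    have b3 : ‖((t, g t) : ℝ × ℝ) - (t₀, g t₀)‖ ≤ |t - t₀| + |g t - g t₀| := by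
      rw [Prod.mk_sub_mk, Prod.norm_mk]
      exact max_le_add_of_nonneg (norm_nonneg _) (norm_nonneg _)
    have b4 := mul_le_mul_of_nonneg_left b3 hε.le
    have b1' := (show ‖Φ (t, g t) - Φ (t₀, g t₀) - ((ContinuousLinearMap.fst ℝ ℝ ℝ).smulRight a
        + (ContinuousLinearMap.snd ℝ ℝ ℝ).smulRight w) ((t, g t) - (t₀, g t₀))‖
        ≤ ε * ‖((t, g t) : ℝ × ℝ) - (t₀, g t₀)‖ from b1)
    rw [Real.norm_eq_abs] at b2
    linarith
  set m := inner ℝ w (x' - a) with hm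
  -- The remainder of `hΦ` still involves |g t - g t₀|. Taking ε = ‖w‖/2 absorbs half of the left
  -- side and yields a Lipschitz bound at t₀, after which the remainder is o(t - t₀).
  obtain ⟨D, hD, hbig⟩ : ∃ D : ℝ, 0 < D ∧ ∀ᶠ t in nhdsWithin t₀ N, |g t - g t₀| ≤ D * |t - t₀| := by
    refine ⟨(|m| + ‖w‖ ^ 2) / (‖w‖ ^ 2 / 2), by positivity, ?_⟩
    filter_upwards [hest (‖w‖ / 2) (by positivity)] with t ht
    have h1 : |‖w‖ ^ 2 * (g t - g t₀)| ≤ |‖w‖ ^ 2 * (g t - g t₀) - (t - t₀) * m|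
        + |(t - t₀) * m| := by
      have := abs_add_le (‖w‖ ^ 2 * (g t - g t₀) - (t - t₀) * m) ((t - t₀) * m)
      rwa [sub_add_cancel] at this
    rw [abs_mul, abs_mul, abs_of_pos (by positivity : 0 < ‖w‖ ^ 2)] at h1
    rw [div_mul_eq_mul_div, le_div_iff₀ (by positivity)]
    nlinarith
  rw [hasDerivWithinAt_iff_isLittleO, Asymptotics.isLittleO_iff]
  intro η hη
  filter_upwards [hest (η * ‖w‖ / (2 + D)) (by positivity), hbig] with t h1 h2
  have h3 : g t - g t₀ - (t - t₀) • (m / ‖w‖ ^ 2)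
      = (‖w‖ ^ 2 * (g t - g t₀) - (t - t₀) * m) / ‖w‖ ^ 2 := by
    rw [smul_eq_mul]; field_simp
  rw [h3, norm_div, Real.norm_eq_abs, Real.norm_eq_abs, Real.norm_eq_abs,
    abs_of_pos (by positivity : 0 < ‖w‖ ^ 2), div_le_iff₀ (by positivity)]
  refine h1.trans ?_
  have h4 : 2 * (η * ‖w‖ / (2 + D)) * |t - t₀| + η * ‖w‖ / (2 + D) * |g t - g t₀|
      ≤ η * ‖w‖ / (2 + D) * ((2 + D) * |t - t₀|) := by
    have : 0 < η * ‖w‖ / (2 + D) := by positivity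
    nlinarith
  have h5 : η * ‖w‖ / (2 + D) * ((2 + D) * |t - t₀|) = η * ‖w‖ * |t - t₀| := by field_simp
  rw [h5] at h4
  nlinarith

/-- Differentiation of an integral with respect to a parameter and the upper limit. -/
theorem hasFDerivWithinAt_parametric_integral {f h : ℝ → ℝ → ℝ} {r₀ r₁ a b : ℝ}
    (hr : r₀ ≤ r₁) (hab : a ≤ b)
    (hf : ContinuousOn (fun z : ℝ × ℝ => f z.1 z.2) (Icc r₀ r₁ ×ˢ Icc a b))
    (hh : ContinuousOn (fun z : ℝ × ℝ => h z.1 z.2) (Icc r₀ r₁ ×ˢ Icc a b))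
    (hfh : ∀ t ∈ Icc r₀ r₁, ∀ β ∈ Icc a b,
      HasDerivWithinAt (fun r => f r β) (h t β) (Icc r₀ r₁) t)
    {t₀ b₀ : ℝ} (ht₀ : t₀ ∈ Icc r₀ r₁) (hb₀ : b₀ ∈ Icc a b) :
    HasFDerivWithinAt (fun z : ℝ × ℝ => ∫ β in a..z.2, f z.1 β)
      ((ContinuousLinearMap.fst ℝ ℝ ℝ).smulRight (∫ β in a..b₀, h t₀ β)
        + (ContinuousLinearMap.snd ℝ ℝ ℝ).smulRight (f t₀ b₀))
      (Icc r₀ r₁ ×ˢ Icc a b) (t₀, b₀) := by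
  -- Clamping both variables to the rectangle extends h to a continuous function on the plane.
  set P : ℝ → ℝ := fun r => (projIcc r₀ r₁ hr r : ℝ) with hP
  set Q : ℝ → ℝ := fun β => (projIcc a b hab β : ℝ) with hQ
  have hPc : Continuous P := continuous_subtype_val.comp continuous_projIcc
  have hQc : Continuous Q := continuous_subtype_val.comp continuous_projIcc
  have hPm : ∀ r, P r ∈ Icc r₀ r₁ := fun r => (projIcc r₀ r₁ hr r).2
  have hQm : ∀ β, Q β ∈ Icc a b := fun β => (projIcc a b hab β).2
  have hPe : ∀ r ∈ Icc r₀ r₁, P r = r := fun r h => by simp [hP, projIcc_of_mem hr h]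
  have hQe : ∀ β ∈ Icc a b, Q β = β := fun β h => by simp [hQ, projIcc_of_mem hab h]
  set g : ℝ → ℝ → ℝ := fun r β => h (P r) (Q β) with hg
  have hgc : Continuous (Function.uncurry g) :=
    hh.comp_continuous (f := fun z : ℝ × ℝ => (P z.1, Q z.2)) (by fun_prop)
      (fun z => ⟨hPm _, hQm _⟩)
  have huIcc : ∀ d ∈ Icc a b, uIcc a d ⊆ Icc a b := fun d hd => by
    rw [uIcc_of_le hd.1]; exact Icc_subset_Icc_right hd.2
  have hint : ∀ t ∈ Icc r₀ r₁, ∀ d ∈ Icc a b, ∫ β in a..d, h t β = ∫ β in a..d, g t β := by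
    intro t ht d hd
    refine intervalIntegral.integral_congr fun β hβ => ?_
    simp only [hg]
    rw [hPe t ht, hQe β (huIcc d hd hβ)]
  have hfe : ∀ t ∈ Icc r₀ r₁, ∀ β ∈ Icc a b, f t β = f r₀ β + ∫ r in r₀..t, g r β := by
    intro t ht β hβ
    have hsub : Icc r₀ t ⊆ Icc r₀ r₁ := Icc_subset_Icc_right ht.2
    have := intervalIntegral.integral_eq_sub_of_hasDeriv_right_of_le ht.1
      (f := fun r => f r β) (f' := fun r => g r β)
      (fun r hr' => ((hfh r (hsub hr') β hβ).continuousWithinAt).mono hsub)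
      (fun r hr' => by
        have h1 := hfh r (hsub (Ioo_subset_Icc_self hr')) β hβ
        have h2 : HasDerivWithinAt (fun r => f r β) (h r β) (Ioi r) r :=
          (h1.hasDerivAt (Icc_mem_nhds hr'.1 (lt_of_lt_of_le hr'.2 ht.2))).hasDerivWithinAt
        refine h2.congr_deriv ?_
        simp only [hg]
        rw [hPe r (hsub (Ioo_subset_Icc_self hr')), hQe β hβ])
      ((hgc.uncurry_right β).intervalIntegrable _ _)
    rw [this]; ring
  -- Fubini writes the integral as a primitive in time, so its time derivative comes from the
  -- fundamental theorem of calculus.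
  have hI : ∀ t ∈ Icc r₀ r₁, ∀ d ∈ Icc a b, ∫ β in a..d, f t β
      = (∫ β in a..d, f r₀ β) + ∫ r in r₀..t, ∫ β in a..d, g r β := by
    intro t ht d hd
    have h1 : ∫ β in a..d, f t β = ∫ β in a..d, (f r₀ β + ∫ r in r₀..t, g r β) :=
      intervalIntegral.integral_congr fun β hβ => hfe t ht β (huIcc d hd hβ)
    rw [h1, intervalIntegral.integral_add]
    · congr 1
      refine intervalIntegral_intervalIntegral_swap (F := fun β r => g r β) ?_
      exact ((hgc.comp continuous_swap).continuousOn.integrableOn_compact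
        (isCompact_uIcc.prod isCompact_uIcc)).mono_set
          (prod_mono uIoc_subset_uIcc uIoc_subset_uIcc)
    · refine ContinuousOn.intervalIntegrable ?_
      exact hf.comp (f := fun β => (r₀, β)) (by fun_prop)
        (fun β hβ => ⟨left_mem_Icc.2 hr, huIcc d hd hβ⟩)
    · refine Continuous.intervalIntegrable ?_ _ _
      exact intervalIntegral.continuous_parametric_intervalIntegral_of_continuous'
        (f := fun β r => g r β) (hgc.comp continuous_swap) _ _
  have hJc : Continuous (fun z : ℝ × ℝ => ∫ β in a..z.2, g z.1 β) :=
    intervalIntegral.continuous_parametric_intervalIntegral_of_continuous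
      (f := fun (z : ℝ × ℝ) β => g z.1 β) (s := fun z => z.2)
      (hgc.comp (f := fun w : (ℝ × ℝ) × ℝ => (w.1.1, w.2)) (by fun_prop)) continuous_snd
  rw [hint t₀ ht₀ b₀ hb₀]
  refine hasFDerivWithinAt_of_partials (Φ := fun t d => ∫ β in a..d, f t β)
    (Φt := fun t d => ∫ β in a..d, g t β) (convex_Icc _ _) ht₀ ?_
    hJc.continuousWithinAt ?_
  · intro t ht d hd
    have hc : Continuous fun r => ∫ β in a..d, g r β :=
      hJc.comp (continuous_id.prodMk continuous_const)
    have h1 := (hc.integral_hasStrictDerivAt r₀ t).hasDerivAt.hasDerivWithinAt (s := Icc r₀ r₁)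
    have h2 := h1.const_add (∫ β in a..d, f r₀ β)
    exact h2.congr (fun r hr' => hI r hr' d hd) (hI t ht d hd)
  · have hfc : Continuous fun β => f t₀ (Q β) :=
      hf.comp_continuous (f := fun β => (t₀, Q β)) (by fun_prop) (fun β => ⟨ht₀, hQm _⟩)
    have h1 := (hfc.integral_hasStrictDerivAt a b₀).hasDerivAt.hasDerivWithinAt (s := Icc a b)
    have h2 : ∀ d ∈ Icc a b, ∫ β in a..d, f t₀ β = ∫ β in a..d, f t₀ (Q β) := fun d hd =>
      intervalIntegral.integral_congr fun β hβ => by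
        rw [hQe β (huIcc d hd hβ)]
    rw [hQe b₀ hb₀] at h1
    exact h1.congr h2 (h2 b₀ hb₀)

end Calculus

end EulerVortex

/-! ### Geometry of a vortex line at a fixed time -/

namespace EulerVortex

variable {u : ℝ → E3 → E3} {t : ℝ}

theorem norm_xi {y : E3} (hy : vorticity u t y ≠ 0) : ‖xi u t y‖ = 1 := by
  rw [xi, norm_smul, norm_inv, norm_norm, inv_mul_cancel₀ (norm_ne_zero_iff.2 hy)]

theorem contDiffAt_xi (hω : ContDiff ℝ ∞ (vorticity u t)) {y : E3} (hy : vorticity u t y ≠ 0) :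
    ContDiffAt ℝ ∞ (xi u t) y :=
  ((hω.contDiffAt.norm ℝ hy).inv (norm_ne_zero_iff.2 hy)).smul hω.contDiffAt

theorem traceCLM_smulRight (φ : E3 →L[ℝ] ℝ) (w : E3) : traceCLM (φ.smulRight w) = φ w := by
  have hw : w = w 0 • EuclideanSpace.single (0 : Fin 3) (1 : ℝ) + w 1 • EuclideanSpace.single 1 1
      + w 2 • EuclideanSpace.single 2 1 := by
    ext i; fin_cases i <;> simp
  conv_rhs => rw [hw]
  simp [traceCLM, Fin.sum_univ_three]
  ring

/-- Along vortex lines `1 / |ω|` has logarithmic derivative `τ`. -/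
theorem fderiv_inv_norm_vorticity (hu : ContDiff ℝ ∞ (u t)) {y : E3} (hy : vorticity u t y ≠ 0) :
    fderiv ℝ (fun z => ‖vorticity u t z‖⁻¹) y (xi u t y) = ‖vorticity u t y‖⁻¹ * tau u t y := by
  have hω : ContDiff ℝ ∞ (vorticity u t) :=
    curlCLM.contDiff.comp (hu.fderiv_right (m := ∞) (by simp))
  have h1 : DifferentiableAt ℝ (fun z => ‖vorticity u t z‖⁻¹) y :=
    ((hω.contDiffAt.norm ℝ hy).inv (norm_ne_zero_iff.2 hy)).differentiableAt (by simp)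
  -- In the product rule for ξ = |ω|⁻¹ω the term |ω|⁻¹ ∇·ω vanishes, so τ is the derivative of |ω|⁻¹
  -- in the direction ω.
  have h2 := h1.hasFDerivAt.smul (hω.differentiable (by simp) y).hasFDerivAt
  have h3 : traceCLM (fderiv ℝ (vorticity u t) y) = 0 := divergence_curl hu y
  have h4 : tau u t y = fderiv ℝ (fun z => ‖vorticity u t z‖⁻¹) y (vorticity u t y) := by
    rw [tau, divergence_eq_traceCLM, show xi u t = (fun z => ‖vorticity u t z‖⁻¹) • vorticity u t
      from rfl, h2.fderiv, map_add, map_smul, h3, traceCLM_smulRight]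
    simp
  rw [h4, xi, map_smul, smul_eq_mul]

/-- The stretching rate `ξ · (∇u) ξ` of vortex lines. -/
noncomputable def stretching (u : ℝ → E3 → E3) (t : ℝ) (y : E3) : ℝ :=
  inner ℝ (xi u t y) (fderiv ℝ (u t) y (xi u t y))

variable {X : ℝ → E3} {ℓ : ℝ}

theorem continuousOn_fderiv_xi_comp (hω : ContDiff ℝ ∞ (vorticity u t)) {S : Set ℝ}
    (hX : ContinuousOn X S) (hne : ∀ s ∈ S, vorticity u t (X s) ≠ 0) :
    ContinuousOn (fun s => fderiv ℝ (xi u t) (X s)) S := fun s hs =>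
  ((contDiffAt_xi hω (hne s hs)).fderiv_right (m := ∞) (by simp)).continuousAt.comp_continuousWithinAt
    (hX s hs)

theorem continuousOn_xi_comp (hω : ContDiff ℝ ∞ (vorticity u t)) {S : Set ℝ}
    (hX : ContinuousOn X S) (hne : ∀ s ∈ S, vorticity u t (X s) ≠ 0) :
    ContinuousOn (fun s => xi u t (X s)) S := fun s hs =>
  (contDiffAt_xi hω (hne s hs)).continuousAt.comp_continuousWithinAt (hX s hs)

/-- The Harnack inequality for the vorticity along a segment of a vortex line. -/
theorem norm_vorticity_le_exp_mul (hu : ContDiff ℝ ∞ (u t))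
    (hne : ∀ s ∈ Icc 0 ℓ, vorticity u t (X s) ≠ 0)
    (hX : ∀ s ∈ Icc 0 ℓ, HasDerivWithinAt X (xi u t (X s)) (Icc 0 ℓ) s) {C₀ : ℝ}
    (hτ : ∫ s in (0 : ℝ)..ℓ, |tau u t (X s)| ≤ C₀) {s₁ s₂ : ℝ} (h₁ : s₁ ∈ Icc 0 ℓ)
    (h₂ : s₂ ∈ Icc 0 ℓ) :
    ‖vorticity u t (X s₁)‖ ≤ Real.exp C₀ * ‖vorticity u t (X s₂)‖ := by
  have hω : ContDiff ℝ ∞ (vorticity u t) :=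
    curlCLM.contDiff.comp (hu.fderiv_right (m := ∞) (by simp))
  have hXc : ContinuousOn X (Icc 0 ℓ) := fun s hs => (hX s hs).continuousWithinAt
  have hτc : ContinuousOn (fun s => tau u t (X s)) (Icc 0 ℓ) :=
    traceCLM.continuous.comp_continuousOn (continuousOn_fderiv_xi_comp hω hXc hne)
  have hpos : ∀ s ∈ Icc 0 ℓ, 0 < ‖vorticity u t (X s)‖ := fun s hs => norm_pos_iff.2 (hne s hs)
  -- Since τ is the arclength derivative of -log|ω|, the oscillation of log|ω| is at most ∫|τ| ds.
  have hd : ∀ s ∈ Icc 0 ℓ, HasDerivWithinAt (fun s => Real.log (‖vorticity u t (X s)‖⁻¹))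
      (tau u t (X s)) (Icc 0 ℓ) s := by
    intro s hs
    have h1 : DifferentiableAt ℝ (fun z => ‖vorticity u t z‖⁻¹) (X s) :=
      ((hω.contDiffAt.norm ℝ (hne s hs)).inv (norm_ne_zero_iff.2 (hne s hs))).differentiableAt
        (by simp)
    have h2 := (h1.hasFDerivAt.comp_hasDerivWithinAt s (hX s hs))
    have h3 := HasDerivWithinAt.log h2 (inv_ne_zero (hpos s hs).ne')
    refine h3.congr_deriv ?_
    rw [fderiv_inv_norm_vorticity hu (hne s hs)]
    have := (hpos s hs).ne'
    simp only [Function.comp]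
    field_simp
  have key : ∀ a ∈ Icc 0 ℓ, ∀ b ∈ Icc 0 ℓ, a ≤ b →
      |Real.log (‖vorticity u t (X b)‖⁻¹) - Real.log (‖vorticity u t (X a)‖⁻¹)| ≤ C₀ := by
    intro a ha b hb hab
    have hsub : Icc a b ⊆ Icc 0 ℓ := Icc_subset_Icc ha.1 hb.2
    have hi := intervalIntegral.integral_eq_sub_of_hasDeriv_right_of_le hab
      (fun s hs => ((hd s (hsub hs)).continuousWithinAt).mono hsub)
      (fun s hs => ((hd s (hsub (Ioo_subset_Icc_self hs))).hasDerivAt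
        (Icc_mem_nhds (lt_of_le_of_lt ha.1 hs.1)
          (lt_of_lt_of_le hs.2 hb.2))).hasDerivWithinAt)
      ((hτc.mono (by rw [uIcc_of_le hab]; exact hsub)).intervalIntegrable)
    rw [← hi]
    refine (intervalIntegral.abs_integral_le_integral_abs hab).trans (le_trans ?_ hτ)
    refine intervalIntegral.integral_mono_interval ha.1 hab hb.2
      (Filter.Eventually.of_forall fun s => abs_nonneg _) ?_
    exact (hτc.abs.mono (by rw [uIcc_of_le (ha.1.trans ha.2)])).intervalIntegrable
  have key2 : |Real.log (‖vorticity u t (X s₂)‖⁻¹) - Real.log (‖vorticity u t (X s₁)‖⁻¹)| ≤ C₀ := by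
    rcases le_total s₁ s₂ with h | h
    · exact key _ h₁ _ h₂ h
    · rw [abs_sub_comm]; exact key _ h₂ _ h₁ h
  rw [Real.log_inv, Real.log_inv] at key2
  have h5 := (abs_le.1 key2).2
  rw [← Real.exp_log (hpos s₁ h₁), ← Real.exp_log (hpos s₂ h₂), ← Real.exp_add]
  exact Real.exp_le_exp.2 (by linarith)

theorem continuousOn_stretching_comp (hu : ContDiff ℝ ∞ (u t)) {S : Set ℝ}
    (hX : ContinuousOn X S) (hne : ∀ s ∈ S, vorticity u t (X s) ≠ 0) :
    ContinuousOn (fun s => stretching u t (X s)) S := by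
  have hω : ContDiff ℝ ∞ (vorticity u t) :=
    curlCLM.contDiff.comp (hu.fderiv_right (m := ∞) (by simp))
  have h1 := continuousOn_xi_comp hω hX hne
  have h2 : ContinuousOn (fun s => fderiv ℝ (u t) (X s)) S :=
    (hu.fderiv_right (m := ∞) (by simp)).continuous.comp_continuousOn hX
  exact h1.inner (𝕜 := ℝ) (h2.clm_apply h1)

/-- The first variation of arclength under the flow is controlled by the maximal velocity. -/
theorem abs_integral_stretching_le (hu : ContDiff ℝ ∞ (u t))
    (hne : ∀ s ∈ Icc 0 ℓ, vorticity u t (X s) ≠ 0)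
    (hX : ∀ s ∈ Icc 0 ℓ, HasDerivWithinAt X (xi u t (X s)) (Icc 0 ℓ) s) {C₀ U : ℝ}
    (hκ : ∫ s in (0 : ℝ)..ℓ, |kappa u t (X s)| ≤ C₀)
    (hU : ∀ s ∈ Icc 0 ℓ, ‖u t (X s)‖ ≤ U) {s₁ : ℝ} (h₁ : s₁ ∈ Icc 0 ℓ) :
    |∫ s in (0 : ℝ)..s₁, stretching u t (X s)| ≤ (2 + C₀) * U := by
  have hω : ContDiff ℝ ∞ (vorticity u t) :=
    curlCLM.contDiff.comp (hu.fderiv_right (m := ∞) (by simp))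
  have hXc : ContinuousOn X (Icc 0 ℓ) := fun s hs => (hX s hs).continuousWithinAt
  have hℓ : 0 ≤ ℓ := h₁.1.trans h₁.2
  have hU0 : 0 ≤ U := (norm_nonneg _).trans (hU 0 (left_mem_Icc.2 hℓ))
  have hξc := continuousOn_xi_comp hω hXc hne
  have hDξ := (continuousOn_fderiv_xi_comp hω hXc hne).clm_apply hξc
  have huc : ContinuousOn (fun s => u t (X s)) (Icc 0 ℓ) := hu.continuous.comp_continuousOn hXc
  have hsub : Icc 0 s₁ ⊆ Icc 0 ℓ := Icc_subset_Icc_right h₁.2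
  have husub : uIcc 0 s₁ ⊆ Icc 0 ℓ := by rwa [uIcc_of_le h₁.1]
  have hsc := continuousOn_stretching_comp hu hXc hne
  set q : ℝ → ℝ := fun s => inner ℝ (fderiv ℝ (xi u t) (X s) (xi u t (X s))) (u t (X s)) with hq
  have hqc : ContinuousOn q (Icc 0 ℓ) := hDξ.inner (𝕜 := ℝ) huc
  -- Integration by parts moves the derivative from u to ξ: the two boundary values of u·ξ account
  -- for the 2, the curvature term for C₀.
  have hd : ∀ s ∈ Icc 0 ℓ, HasDerivWithinAt (fun s => inner ℝ (xi u t (X s)) (u t (X s)))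
      (stretching u t (X s) + q s) (Icc 0 ℓ) s := by
    intro s hs
    have h1 := ((contDiffAt_xi hω (hne s hs)).differentiableAt
      (by simp)).hasFDerivAt.comp_hasDerivWithinAt s (hX s hs)
    have h2 := (hu.differentiable (by simp) (X s)).hasFDerivAt.comp_hasDerivWithinAt s (hX s hs)
    exact h1.inner ℝ h2
  have hi := intervalIntegral.integral_eq_sub_of_hasDeriv_right_of_le h₁.1
      (fun s hs => ((hd s (hsub hs)).continuousWithinAt).mono hsub)
      (fun s hs => ((hd s (hsub (Ioo_subset_Icc_self hs))).hasDerivAt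
        (Icc_mem_nhds hs.1 (lt_of_lt_of_le hs.2 h₁.2))).hasDerivWithinAt)
      (((hsc.add hqc).mono husub).intervalIntegrable)
  rw [intervalIntegral.integral_add (hsc.mono husub).intervalIntegrable
    (hqc.mono husub).intervalIntegrable] at hi
  have hb : ∀ s ∈ Icc 0 ℓ, |inner ℝ (xi u t (X s)) (u t (X s))| ≤ U := fun s hs =>
    (abs_real_inner_le_norm _ _).trans (by rw [norm_xi (hne s hs), one_mul]; exact hU s hs)
  have hqb : |∫ s in (0 : ℝ)..s₁, q s| ≤ C₀ * U := by
    have hκc : ContinuousOn (fun s => |kappa u t (X s)|) (Icc 0 ℓ) := hDξ.norm.abs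
    calc |∫ s in (0 : ℝ)..s₁, q s| ≤ ∫ s in (0 : ℝ)..s₁, |q s| :=
          intervalIntegral.abs_integral_le_integral_abs h₁.1
      _ ≤ ∫ s in (0 : ℝ)..ℓ, |q s| :=
          intervalIntegral.integral_mono_interval le_rfl h₁.1 h₁.2
            (Filter.Eventually.of_forall fun s => abs_nonneg _)
            (hqc.abs.mono (by rw [uIcc_of_le hℓ])).intervalIntegrable
      _ ≤ ∫ s in (0 : ℝ)..ℓ, |kappa u t (X s)| * U := by
          refine intervalIntegral.integral_mono_on hℓ
            (hqc.abs.mono (by rw [uIcc_of_le hℓ])).intervalIntegrable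
            ((hκc.mul continuousOn_const).mono (by rw [uIcc_of_le hℓ])).intervalIntegrable ?_
          intro s hs
          refine (abs_real_inner_le_norm _ _).trans ?_
          exact mul_le_mul (le_abs_self _) (hU s hs) (norm_nonneg _) (abs_nonneg _)
      _ ≤ C₀ * U := by
          rw [intervalIntegral.integral_mul_const]
          exact mul_le_mul_of_nonneg_right hκ hU0
  have h1 := abs_le.1 (hb s₁ h₁)
  have h2 := abs_le.1 (hb 0 (left_mem_Icc.2 hℓ))
  have h3 := abs_le.1 hqb
  rw [abs_le]
  constructor <;> linarith

end EulerVortex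

/-! ### Stretching, labels and arclength on a transported vortex line -/

namespace EulerVortex

variable {T : EReal} {u : ℝ → E3 → E3} {p : ℝ → E3 → ℝ} {T₀ : ℝ} {J : Set ℝ} {Y : ℝ → ℝ → E3}

theorem convex_timesFrom : Convex ℝ (timesFrom T T₀) := by
  refine Set.OrdConnected.convex ⟨fun a ha b hb c hc => ⟨ha.1.trans hc.1, ?_⟩⟩
  exact lt_of_le_of_lt (EReal.coe_le_coe_iff.2 hc.2) hb.2

/-- The vorticity does not vanish on a transported vortex line. -/
theorem IsMaterialVortexLine.vorticity_ne_zero (h : IsEulerSolution T u p) (hT : 0 < T)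
    (h0 : 0 ≤ T₀) (hY : IsMaterialVortexLine T u T₀ J Y) {β : ℝ} (hβ : β ∈ J)
    {t : ℝ} (ht : t ∈ timesFrom T T₀) : vorticity u t (Y t β) ≠ 0 := by
  have hsub := Icc_subset_timesFrom (T₀ := T₀) ht.2
  obtain ⟨R, hR⟩ := isCompact_Icc.exists_bound_of_continuousOn
    ((hY.continuousOn_time hβ).mono hsub)
  obtain ⟨K, hK1, hK⟩ := h.exists_bound hT h0 ht.2 R
  have hd : ∀ s ∈ Icc T₀ t, HasDerivWithinAt (fun s => ‖vorticity u s (Y s β)‖ ^ 2)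
      (2 * inner ℝ (vorticity u s (Y s β)) (fderiv ℝ (u s) (Y s β) (vorticity u s (Y s β))))
      (Ici T₀) s := fun s hs =>
    (h.vorticity_along hT h0 hs.1 (hsub hs).2 (hY.trajectory β hβ s hs.1 (hsub hs).2)).norm_sq
  -- Grönwall from below: |ω|² decays at rate at most 2K, so |ω|² e^{2Ks} is nondecreasing and stays
  -- positive.
  have hd2 : ∀ s ∈ Icc T₀ t, HasDerivWithinAt
      (fun s => ‖vorticity u s (Y s β)‖ ^ 2 * Real.exp (2 * K * s))
      (2 * inner ℝ (vorticity u s (Y s β)) (fderiv ℝ (u s) (Y s β) (vorticity u s (Y s β)))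
        * Real.exp (2 * K * s)
        + ‖vorticity u s (Y s β)‖ ^ 2 * (Real.exp (2 * K * s) * (2 * K))) (Ici T₀) s := by
    intro s hs
    have he : HasDerivAt (fun s : ℝ => Real.exp (2 * K * s)) (Real.exp (2 * K * s) * (2 * K)) s := by
      simpa using ((hasDerivAt_id s).const_mul (2 * K)).exp
    exact (hd s hs).mul he.hasDerivWithinAt
  have hmono : MonotoneOn (fun s => ‖vorticity u s (Y s β)‖ ^ 2 * Real.exp (2 * K * s))
      (Icc T₀ t) := by
    refine monotoneOn_of_deriv_nonneg (convex_Icc _ _)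
      (fun s hs => ((hd2 s hs).continuousWithinAt).mono Icc_subset_Ici_self) ?_ ?_
    · rw [interior_Icc]
      intro s hs
      exact ((hd2 s (Ioo_subset_Icc_self hs)).hasDerivAt
        (Ici_mem_nhds hs.1)).differentiableAt.differentiableWithinAt
    · rw [interior_Icc]
      intro s hs
      have hs' := Ioo_subset_Icc_self hs
      rw [((hd2 s hs').hasDerivAt (Ici_mem_nhds hs.1)).deriv]
      have h1 := (abs_le.1 (abs_real_inner_le_norm (vorticity u s (Y s β))
        (fderiv ℝ (u s) (Y s β) (vorticity u s (Y s β))))).1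
      have h2 := (fderiv ℝ (u s) (Y s β)).le_of_opNorm_le
        (hK s hs' (Y s β) (by rw [mem_closedBall_zero_iff]; exact hR s hs')).1
        (vorticity u s (Y s β))
      have h3 := mul_le_mul_of_nonneg_left h2 (norm_nonneg (vorticity u s (Y s β)))
      have h4 : 0 ≤ 2 * inner ℝ (vorticity u s (Y s β))
          (fderiv ℝ (u s) (Y s β) (vorticity u s (Y s β)))
          + 2 * K * ‖vorticity u s (Y s β)‖ ^ 2 := by nlinarith
      have h5 := mul_nonneg h4 (Real.exp_pos (2 * K * s)).le
      linarith
  have hle := hmono (left_mem_Icc.2 ht.1) (right_mem_Icc.2 ht.1) ht.1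
  intro hzero
  simp only [hzero, norm_zero] at hle
  have hp : 0 < ‖vorticity u T₀ (Y T₀ β)‖ := norm_pos_iff.2 (hY.nonvanishing β hβ)
  have : 0 < ‖vorticity u T₀ (Y T₀ β)‖ ^ 2 * Real.exp (2 * K * T₀) := by positivity
  simp at hle
  linarith

/-- The speed `|∂_β Y|` of the parametrization of a transported vortex line. -/
noncomputable def lineSpeed (u : ℝ → E3 → E3) (T₀ : ℝ) (Y : ℝ → ℝ → E3) (t β : ℝ) : ℝ :=
  lineDensity u T₀ Y β * ‖vorticity u t (Y t β)‖

/-- The time derivative of `lineSpeed`. -/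
noncomputable def lineStretch (u : ℝ → E3 → E3) (T₀ : ℝ) (Y : ℝ → ℝ → E3) (t β : ℝ) : ℝ :=
  lineSpeed u T₀ Y t β * stretching u t (Y t β)

theorem IsMaterialVortexLine.lineSpeed_pos (h : IsEulerSolution T u p) (hT : 0 < T)
    (h0 : 0 ≤ T₀) (hY : IsMaterialVortexLine T u T₀ J Y) {β : ℝ} (hβ : β ∈ J)
    {t : ℝ} (ht : t ∈ timesFrom T T₀) : 0 < lineSpeed u T₀ Y t β :=
  mul_pos (hY.lineDensity_pos hβ) (norm_pos_iff.2 (hY.vorticity_ne_zero h hT h0 hβ ht))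

/-- By the vorticity equation |ω| has logarithmic derivative ξ·(∇u)ξ along trajectories, and the
density factor does not depend on time. -/
theorem IsMaterialVortexLine.hasDerivWithinAt_lineSpeed (h : IsEulerSolution T u p) (hT : 0 < T)
    (h0 : 0 ≤ T₀) (hY : IsMaterialVortexLine T u T₀ J Y) {β : ℝ} (hβ : β ∈ J)
    {t : ℝ} (ht : t ∈ timesFrom T T₀) :
    HasDerivWithinAt (fun r => lineSpeed u T₀ Y r β) (lineStretch u T₀ Y t β) (Ici T₀) t := by
  have hne := norm_ne_zero_iff.2 (hY.vorticity_ne_zero h hT h0 hβ ht)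
  have h1 := ((h.vorticity_along hT h0 ht.1 ht.2 (hY.trajectory β hβ t ht.1 ht.2)).norm_sq.sqrt
    (pow_ne_zero 2 hne)).const_mul (lineDensity u T₀ Y β)
  simp only [Real.sqrt_sq (norm_nonneg _)] at h1
  refine h1.congr_deriv ?_
  simp only [lineStretch, lineSpeed, stretching, xi, map_smul, inner_smul_left, inner_smul_right]
  simp
  field_simp

theorem IsMaterialVortexLine.continuousOn_vorticity (h : IsEulerSolution T u p) (hT : 0 < T)
    (h0 : 0 ≤ T₀) (hY : IsMaterialVortexLine T u T₀ J Y) :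
    ContinuousOn (fun z : ℝ × ℝ => vorticity u z.1 (Y z.1 z.2)) (timesFrom T T₀ ×ˢ J) :=
  (h.contDiffOn_vorticity hT).continuousOn.comp (f := fun z : ℝ × ℝ => (z.1, Y z.1 z.2))
    (continuousOn_fst.prodMk (hY.continuousOn_uncurry h hT h0))
    (fun _ hz => ⟨timesFrom_subset h0 hz.1, mem_univ _⟩)

theorem IsMaterialVortexLine.continuousOn_lineSpeed (h : IsEulerSolution T u p) (hT : 0 < T)
    (h0 : 0 ≤ T₀) (hT₀ : (T₀ : EReal) < T) (hY : IsMaterialVortexLine T u T₀ J Y) :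
    ContinuousOn (fun z : ℝ × ℝ => lineSpeed u T₀ Y z.1 z.2) (timesFrom T T₀ ×ˢ J) :=
  ((hY.continuousOn_lineDensity h h0 hT₀).comp continuousOn_snd (fun _ hz => hz.2)).mul
    (hY.continuousOn_vorticity h hT h0).norm

theorem IsMaterialVortexLine.continuousOn_lineStretch (h : IsEulerSolution T u p) (hT : 0 < T)
    (h0 : 0 ≤ T₀) (hT₀ : (T₀ : EReal) < T) (hY : IsMaterialVortexLine T u T₀ J Y) :
    ContinuousOn (fun z : ℝ × ℝ => lineStretch u T₀ Y z.1 z.2) (timesFrom T T₀ ×ˢ J) := by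
  have hω := hY.continuousOn_vorticity h hT h0
  have hξ : ContinuousOn (fun z : ℝ × ℝ => xi u z.1 (Y z.1 z.2)) (timesFrom T T₀ ×ˢ J) :=
    (hω.norm.inv₀ fun z hz =>
      norm_ne_zero_iff.2 (hY.vorticity_ne_zero h hT h0 hz.2 hz.1)).smul hω
  have hD : ContinuousOn (fun z : ℝ × ℝ => fderiv ℝ (u z.1) (Y z.1 z.2)) (timesFrom T T₀ ×ˢ J) :=
    (contDiffOn_fderiv_slice (uniqueDiffOn_timeInterval hT) h.smooth_velocity).continuousOn.comp
      (f := fun z : ℝ × ℝ => (z.1, Y z.1 z.2))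
      (continuousOn_fst.prodMk (hY.continuousOn_uncurry h hT h0))
      (fun _ hz => ⟨timesFrom_subset h0 hz.1, mem_univ _⟩)
  exact (hY.continuousOn_lineSpeed h hT h0 hT₀).mul (hξ.inner (𝕜 := ℝ) (hD.clm_apply hξ))

theorem continuousOn_right_of_prod {I J : Set ℝ} {f : ℝ → ℝ → ℝ}
    (hf : ContinuousOn (fun z : ℝ × ℝ => f z.1 z.2) (I ×ˢ J)) {t : ℝ} (ht : t ∈ I) :
    ContinuousOn (f t) J :=
  hf.comp (f := fun β => (t, β)) (by fun_prop) (fun _ hβ => ⟨ht, hβ⟩)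

theorem norm_smul_xi (t : ℝ) (y : E3) : ‖vorticity u t y‖ • xi u t y = vorticity u t y := by
  by_cases hy : vorticity u t y = 0
  · simp [hy]
  · rw [xi, smul_smul, mul_inv_cancel₀ (norm_ne_zero_iff.2 hy), one_smul]

/-- The derivative of a transported vortex line in the label, in terms of `ξ`. -/
theorem IsMaterialVortexLine.hasDerivWithinAt_label_xi (h : IsEulerSolution T u p) (hT : 0 < T)
    (h0 : 0 ≤ T₀) (hY : IsMaterialVortexLine T u T₀ J Y) {β : ℝ} (hβ : β ∈ J)
    {t : ℝ} (ht : t ∈ timesFrom T T₀) :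
    HasDerivWithinAt (Y t) (lineSpeed u T₀ Y t β • xi u t (Y t β)) J β := by
  refine (hY.hasDerivWithinAt_label h hT h0 hβ ht).congr_deriv ?_
  rw [lineSpeed, mul_smul, norm_smul_xi]

/-- The labels of an arclength parametrized piece of a transported vortex line. -/
theorem IsMaterialVortexLine.hasDerivWithinAt_lab (h : IsEulerSolution T u p) (hT : 0 < T)
    (h0 : 0 ≤ T₀) (hY : IsMaterialVortexLine T u T₀ J Y) {t : ℝ} (ht : t ∈ timesFrom T T₀)
    {X : ℝ → E3} {b : ℝ → ℝ} {S : Set ℝ} (hb : ContinuousOn b S)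
    (hbX : ∀ s ∈ S, b s ∈ J ∧ X s = Y t (b s)) {s : ℝ} (hs : s ∈ S)
    (hX : HasDerivWithinAt X (xi u t (X s)) S s) :
    HasDerivWithinAt b (lineSpeed u T₀ Y t (b s))⁻¹ S s := by
  have hpos := hY.lineSpeed_pos h hT h0 (hbX s hs).1 ht
  have hne := hY.vorticity_ne_zero h hT h0 (hbX s hs).1 ht
  set w := lineSpeed u T₀ Y t (b s) • xi u t (Y t (b s)) with hw
  have hwn : ‖w‖ = lineSpeed u T₀ Y t (b s) := by
    rw [hw, norm_smul, norm_xi hne, mul_one, Real.norm_of_nonneg hpos.le]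
  have hw0 : w ≠ 0 := by rw [← norm_ne_zero_iff, hwn]; exact hpos.ne'
  -- With a first variable on which nothing depends, inverting the label parametrization becomes a
  -- case of the implicit function lemma.
  have hΦ : HasFDerivWithinAt (fun z : ℝ × ℝ => Y t z.2)
      ((ContinuousLinearMap.fst ℝ ℝ ℝ).smulRight (0 : E3)
        + (ContinuousLinearMap.snd ℝ ℝ ℝ).smulRight w) (univ ×ˢ J) (s, b s) := by
    refine ((hY.hasDerivWithinAt_label_xi h hT h0 (hbX s hs).1 ht).hasFDerivWithinAt.comp
      (s, b s) hasFDerivWithinAt_snd (fun z hz => hz.2)).congr_fderiv ?_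
    ext <;> simp [hw]
  have := hasDerivWithinAt_implicit (x' := xi u t (X s)) (N := S) hw0 hΦ (hb s hs)
    (fun r hr => ⟨mem_univ _, (hbX r hr).1⟩)
    (hX.congr (fun r hr => (hbX r hr).2.symm) (hbX s hs).2.symm)
  refine this.congr_deriv ?_
  rw [sub_zero, hwn, (hbX s hs).2, hw, real_inner_smul_left, real_inner_self_eq_norm_sq,
    norm_xi hne]
  field_simp

/-- Change of variables from labels to arclength. -/
theorem IsMaterialVortexLine.integral_label_eq (h : IsEulerSolution T u p) (hT : 0 < T)
    (h0 : 0 ≤ T₀) (hT₀ : (T₀ : EReal) < T) (hY : IsMaterialVortexLine T u T₀ J Y) {t : ℝ}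
    (ht : t ∈ timesFrom T T₀)
    {X : ℝ → E3} {b : ℝ → ℝ} {ℓ : ℝ} (hb : ContinuousOn b (Icc 0 ℓ))
    (hbX : ∀ s ∈ Icc 0 ℓ, b s ∈ J ∧ X s = Y t (b s))
    (hX : ∀ s ∈ Icc 0 ℓ, HasDerivWithinAt X (xi u t (X s)) (Icc 0 ℓ) s)
    {g : ℝ → ℝ} (hg : ContinuousOn g J) {s₁ : ℝ} (hs₁ : s₁ ∈ Icc 0 ℓ) :
    ∫ β in b 0..b s₁, g β * lineSpeed u T₀ Y t β = ∫ s in (0 : ℝ)..s₁, g (b s) := by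
  have hsub : Icc 0 s₁ ⊆ Icc 0 ℓ := Icc_subset_Icc_right hs₁.2
  have hfc := continuousOn_right_of_prod (hY.continuousOn_lineSpeed h hT h0 hT₀) ht
  have hmaps : MapsTo b (Icc 0 s₁) J := fun s hs => (hbX s (hsub hs)).1
  have hbc := hb.mono hsub
  have hpos : ∀ s ∈ Icc 0 s₁, lineSpeed u T₀ Y t (b s) ≠ 0 := fun s hs =>
    (hY.lineSpeed_pos h hT h0 (hmaps hs) ht).ne'
  have key := intervalIntegral.integral_comp_mul_deriv'' (f := b)
    (f' := fun s => (lineSpeed u T₀ Y t (b s))⁻¹) (g := fun β => g β * lineSpeed u T₀ Y t β)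
    (a := 0) (b := s₁) (by rwa [uIcc_of_le hs₁.1])
    (fun s hs => by
      rw [min_eq_left hs₁.1, max_eq_right hs₁.1] at hs
      exact ((hY.hasDerivWithinAt_lab h hT h0 ht hb hbX (hsub (Ioo_subset_Icc_self hs))
        (hX s (hsub (Ioo_subset_Icc_self hs)))).hasDerivAt
        (Icc_mem_nhds hs.1 (lt_of_lt_of_le hs.2 hs₁.2))).hasDerivWithinAt)
    (by
      rw [uIcc_of_le hs₁.1]
      exact (hfc.comp hbc hmaps).inv₀ hpos)
    (by
      rw [uIcc_of_le hs₁.1]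
      exact (hg.mul hfc).mono hmaps.image_subset)
  rw [← key]
  refine intervalIntegral.integral_congr fun s hs => ?_
  rw [uIcc_of_le hs₁.1] at hs
  simp only [Function.comp]
  rw [mul_assoc, mul_inv_cancel₀ (hpos s hs), mul_one]

end EulerVortex

/-! ### Moving intervals of constant mass -/

namespace EulerVortex

theorem integral_add_of_continuousOn {J : Set ℝ} (hJ : J.OrdConnected) {g : ℝ → ℝ}
    (hg : ContinuousOn g J) {a b c : ℝ} (ha : a ∈ J) (hb : b ∈ J) (hc : c ∈ J) :
    (∫ x in a..b, g x) + ∫ x in b..c, g x = ∫ x in a..c, g x :=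
  intervalIntegral.integral_add_adjacent_intervals
    (hg.mono (hJ.uIcc_subset ha hb)).intervalIntegrable
    (hg.mono (hJ.uIcc_subset hb hc)).intervalIntegrable

theorem integral_pos_of_continuousOn {J : Set ℝ} (hJ : J.OrdConnected) {g : ℝ → ℝ}
    (hg : ContinuousOn g J) (hpos : ∀ x ∈ J, 0 < g x) {a b : ℝ} (ha : a ∈ J) (hb : b ∈ J)
    (hab : a < b) : 0 < ∫ x in a..b, g x :=
  intervalIntegral.intervalIntegral_pos_of_pos_on
    (hg.mono (hJ.uIcc_subset ha hb)).intervalIntegrable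
    (fun x hx => hpos x (hJ.out ha hb (Ioo_subset_Icc_self hx))) hab

/-- There may be no room in `J` to the left of `b₀ t₀`; but then `b₀ t₀` is the least element of `J`
and serves as `a` itself. -/
theorem exists_eventually_le_of_ordConnected {J K : Set ℝ} {b₀ : ℝ → ℝ} {t₀ : ℝ}
    (hb₀ : ∀ t ∈ K, b₀ t ∈ J) (ht₀ : t₀ ∈ K) (hc : ContinuousWithinAt b₀ K t₀) :
    ∃ a ∈ J, a ≤ b₀ t₀ ∧ ∀ᶠ t in nhdsWithin t₀ K, a ≤ b₀ t := by
  by_cases hlt : ∃ a ∈ J, a < b₀ t₀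
  · obtain ⟨a, ha, hab⟩ := hlt
    exact ⟨a, ha, hab.le, (hc.eventually (Ioi_mem_nhds hab)).mono fun t ht => le_of_lt ht⟩
  · push Not at hlt
    refine ⟨b₀ t₀, hb₀ t₀ ht₀, le_rfl, ?_⟩
    filter_upwards [self_mem_nhdsWithin] with t ht using hlt _ (hb₀ t ht)

/-- Let `f` be a positive density on `J` evolving in time, and let `[b₀ t, b₁ t] ⊆ J` be intervals
of constant mass with `b₀` differentiable. Then the measure of `[b₀ t, b₁ t]` with respect to a
density `c` that does not depend on time is differentiable in time. -/
theorem exists_hasDerivWithinAt_integral_of_mass_eq {T : EReal} {T₀ : ℝ} {J : Set ℝ}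
    (hJ : J.OrdConnected) {f h : ℝ → ℝ → ℝ} {c b₀ b₁ : ℝ → ℝ} {ℓ m₀ t₀ b : ℝ}
    (hf : ContinuousOn (fun z : ℝ × ℝ => f z.1 z.2) (timesFrom T T₀ ×ˢ J))
    (hh : ContinuousOn (fun z : ℝ × ℝ => h z.1 z.2) (timesFrom T T₀ ×ˢ J))
    (hc : ContinuousOn c J)
    (hpos : ∀ t ∈ timesFrom T T₀, ∀ β ∈ J, 0 < f t β)
    (hfh : ∀ t ∈ timesFrom T T₀, ∀ β ∈ J, HasDerivWithinAt (fun r => f r β) (h t β) (Ici T₀) t)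
    (hb₀ : ∀ t ∈ timesFrom T T₀, b₀ t ∈ J) (hb₁ : ∀ t ∈ timesFrom T T₀, b₁ t ∈ J)
    (hlt : ∀ t ∈ timesFrom T T₀, b₀ t < b₁ t)
    (hmass : ∀ t ∈ timesFrom T T₀, ∫ β in b₀ t..b₁ t, f t β = ℓ)
    (ht₀ : t₀ ∈ timesFrom T T₀) (hm₀ : HasDerivWithinAt b₀ m₀ (timesFrom T T₀) t₀)
    (hb : b ∈ J) (hbb : b₁ t₀ < b) :
    ∃ m₁ : ℝ, f t₀ (b₁ t₀) * m₁ = f t₀ (b₀ t₀) * m₀ - ∫ β in b₀ t₀..b₁ t₀, h t₀ β ∧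
      HasDerivWithinAt (fun t => ∫ β in b₀ t..b₁ t, c β) (c (b₁ t₀) * m₁ - c (b₀ t₀) * m₀)
        (timesFrom T T₀) t₀ := by
  set K := timesFrom T T₀ with hK
  obtain ⟨t₁, htt₁, ht₁⟩ := exists_time_between ht₀
  obtain ⟨a, ha, hab₀, hae⟩ := exists_eventually_le_of_ordConnected hb₀ ht₀ hm₀.continuousWithinAt
  have hb₀b : b₀ t₀ < b := (hlt t₀ ht₀).trans hbb
  have hab : a ≤ b := hab₀.trans hb₀b.le
  have hIJ : Icc a b ⊆ J := hJ.out ha hb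
  have hIK : Icc T₀ t₁ ⊆ K := Icc_subset_timesFrom ht₁
  have hT₀t₁ : T₀ ≤ t₁ := ht₀.1.trans htt₁.le
  have ht₀I : t₀ ∈ Icc T₀ t₁ := ⟨ht₀.1, htt₁.le⟩
  have hsub : Icc T₀ t₁ ×ˢ Icc a b ⊆ K ×ˢ J := prod_mono hIK hIJ
  have hft : ∀ t ∈ K, ContinuousOn (f t) J := fun t ht => continuousOn_right_of_prod hf ht
  have hht : ContinuousOn (h t₀) J := continuousOn_right_of_prod hh ht₀
  set F : ℝ × ℝ → ℝ := fun z => ∫ β in a..z.2, f z.1 β with hF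
  have hFd : ∀ d ∈ Icc a b, HasFDerivWithinAt F
      ((ContinuousLinearMap.fst ℝ ℝ ℝ).smulRight (∫ β in a..d, h t₀ β)
        + (ContinuousLinearMap.snd ℝ ℝ ℝ).smulRight (f t₀ d))
      (Icc T₀ t₁ ×ˢ Icc a b) (t₀, d) := fun d hd =>
    hasFDerivWithinAt_parametric_integral hT₀t₁ hab (hf.mono hsub) (hh.mono hsub)
      (fun t ht β hβ => (hfh t (hIK ht) β (hIJ hβ)).mono Icc_subset_Ici_self) ht₀I hd
  have hGd : ∀ d ∈ Icc a b, HasFDerivWithinAt (fun z : ℝ × ℝ => ∫ β in a..z.2, c β)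
      ((ContinuousLinearMap.fst ℝ ℝ ℝ).smulRight (∫ β in a..d, (0 : ℝ))
        + (ContinuousLinearMap.snd ℝ ℝ ℝ).smulRight (c d))
      (Icc T₀ t₁ ×ˢ Icc a b) (t₀, d) := fun d hd =>
    hasFDerivWithinAt_parametric_integral (f := fun _ β => c β) (h := fun _ _ => 0) hT₀t₁ hab
      ((hc.mono hIJ).comp continuousOn_snd (fun z hz => hz.2)) continuousOn_const
      (fun t _ β _ => hasDerivWithinAt_const _ _ _) ht₀I hd
  set N : Set ℝ := {t | t ∈ Icc T₀ t₁ ∧ b₀ t ∈ Icc a b} with hN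
  have hNK : N ⊆ K := fun t ht => hIK ht.1
  have hNnhds : N ∈ nhdsWithin t₀ K := by
    filter_upwards [self_mem_nhdsWithin, mem_nhdsWithin_of_mem_nhds (Iio_mem_nhds htt₁), hae,
      hm₀.continuousWithinAt.eventually (Iio_mem_nhds hb₀b)] with t h1 h2 h3 h4
    exact ⟨⟨h1.1, le_of_lt h2⟩, h3, le_of_lt h4⟩
  have ht₀N : t₀ ∈ N := ⟨ht₀I, hab₀, hb₀b.le⟩
  have hφ : HasDerivWithinAt (fun t => F (t, b₀ t))
      ((∫ β in a..b₀ t₀, h t₀ β) + m₀ * f t₀ (b₀ t₀)) N t₀ := by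
    have := (hFd (b₀ t₀) ht₀N.2).comp_hasDerivWithinAt (f := fun t => (t, b₀ t)) t₀
      ((hasDerivWithinAt_id t₀ N).prodMk (hm₀.mono hNK)) (fun t ht => ⟨ht.1, ht.2⟩)
    exact this.congr_deriv (by simp)
  have hψ : ∀ d ∈ Icc a b, ContinuousWithinAt (fun t => ∫ β in b₀ t..d, f t β) N t₀ := by
    intro d hd
    have h1 : ContinuousWithinAt (fun t => F (t, d)) N t₀ :=
      (hFd d hd).continuousWithinAt.comp (f := fun t => (t, d))
        (continuousWithinAt_id.prodMk continuousWithinAt_const) (fun t ht => ⟨ht.1, hd⟩)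
    have h2 : ∀ t ∈ N, ∫ β in b₀ t..d, f t β = F (t, d) - F (t, b₀ t) := fun t ht =>
      eq_sub_of_add_eq' (integral_add_of_continuousOn hJ (hft t (hNK ht)) ha (hb₀ t (hNK ht))
        (hIJ hd))
    exact (h1.sub hφ.continuousWithinAt).congr h2 (h2 t₀ ht₀N)
  have hsplit : ∀ t ∈ K, ∀ d ∈ J, (∫ β in b₀ t..d, f t β) + ∫ β in d..b₁ t, f t β = ℓ :=
    fun t ht d hd => (integral_add_of_continuousOn hJ (hft t ht) (hb₀ t ht) hd (hb₁ t ht)).trans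
      (hmass t ht)
  have hnonneg : ∀ t ∈ K, ∀ c ∈ J, ∀ d ∈ J, c ≤ d → 0 ≤ ∫ β in c..d, f t β :=
    fun t ht c hc d hd hcd => intervalIntegral.integral_nonneg hcd
      (fun x hx => (hpos t ht x (hJ.out hc hd hx)).le)
  -- Continuity of `b₁` is not assumed. It follows from f > 0: the mass of [b₀ t, d] varies
  -- continuously in t, and comparing it with ℓ tells on which side of d the point `b₁ t` lies.
  have hlow : ∀ d ∈ Icc a b, d < b₁ t₀ → ∀ᶠ t in nhdsWithin t₀ N, d < b₁ t := by
    intro d hd hdb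
    have h1 := integral_pos_of_continuousOn hJ (hft t₀ ht₀) (hpos t₀ ht₀) (hIJ hd) (hb₁ t₀ ht₀) hdb
    have h2 := hsplit t₀ ht₀ d (hIJ hd)
    filter_upwards [(hψ d hd).eventually (Iio_mem_nhds (show _ < ℓ by linarith)),
      self_mem_nhdsWithin] with t h3 htN
    by_contra hcon
    push Not at hcon
    have h4 := hnonneg t (hNK htN) _ (hb₁ t (hNK htN)) d (hIJ hd) hcon
    have h5 := hsplit t (hNK htN) d (hIJ hd)
    rw [intervalIntegral.integral_symm (b₁ t) d] at h5
    have h3' : (∫ β in b₀ t..d, f t β) < ℓ := h3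
    linarith
  have hupp : ∀ d ∈ Icc a b, b₁ t₀ < d → ∀ᶠ t in nhdsWithin t₀ N, b₁ t < d := by
    intro d hd hdb
    have h1 := integral_pos_of_continuousOn hJ (hft t₀ ht₀) (hpos t₀ ht₀) (hb₁ t₀ ht₀) (hIJ hd) hdb
    have h2 := hsplit t₀ ht₀ d (hIJ hd)
    rw [intervalIntegral.integral_symm (b₁ t₀) d] at h2
    filter_upwards [(hψ d hd).eventually (Ioi_mem_nhds (show ℓ < _ by linarith)),
      self_mem_nhdsWithin] with t h3 htN
    by_contra hcon
    push Not at hcon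
    have h4 := hnonneg t (hNK htN) d (hIJ hd) _ (hb₁ t (hNK htN)) hcon
    have h5 := hsplit t (hNK htN) d (hIJ hd)
    have h3' : ℓ < (∫ β in b₀ t..d, f t β) := h3
    linarith
  have hab₁ : a ≤ b₁ t₀ := hab₀.trans (hlt t₀ ht₀).le
  have hb₁c : ContinuousWithinAt b₁ N t₀ := by
    refine tendsto_order.2 ⟨fun d hd => ?_, fun d hd => ?_⟩
    · refine (hlow (max d (b₀ t₀)) ⟨hab₀.trans (le_max_right _ _), ?_⟩ ?_).mono
        fun t ht => lt_of_le_of_lt (le_max_left _ _) ht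
      · exact max_le (hd.le.trans hbb.le) hb₀b.le
      · exact max_lt hd (hlt t₀ ht₀)
    · refine (hupp (min d b) ⟨le_min (hab₁.trans (le_of_lt hd)) hab, min_le_right _ _⟩ ?_).mono
        fun t ht => lt_of_lt_of_le ht (min_le_left _ _)
      exact lt_min hd hbb
  set N₁ : Set ℝ := {t | t ∈ N ∧ b₁ t ∈ Icc a b} with hN₁
  have hN₁N : N₁ ⊆ N := fun t ht => ht.1
  have hN₁nhds : N₁ ∈ nhdsWithin t₀ N := by
    filter_upwards [self_mem_nhdsWithin, hupp b ⟨hab, le_rfl⟩ hbb] with t h1 h2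
    exact ⟨h1, h1.2.1.trans (hlt t (hNK h1)).le, h2.le⟩
  have hN₁K : N₁ ∈ nhdsWithin t₀ K := by
    refine nhdsWithin_le_of_mem ?_ hN₁nhds
    exact hNnhds
  have ht₀N₁ : t₀ ∈ N₁ := ⟨ht₀N, hab₁, hbb.le⟩
  have hFe : ∀ t ∈ N₁, F (t, b₁ t) = F (t, b₀ t) + ℓ := fun t ht => by
    rw [← hmass t (hNK ht.1)]
    exact (integral_add_of_continuousOn hJ (hft t (hNK ht.1)) ha (hb₀ t (hNK ht.1))
      (hb₁ t (hNK ht.1))).symm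
  have hf₁ : 0 < f t₀ (b₁ t₀) := hpos t₀ ht₀ _ (hb₁ t₀ ht₀)
  -- The end point `b₁` is differentiated as the implicit solution of F(t, b₁) = F(t, b₀) + ℓ.
  have himp := hasDerivWithinAt_implicit (N := N₁) hf₁.ne' (hFd (b₁ t₀) ht₀N₁.2)
    (hb₁c.mono hN₁N) (fun t ht => ⟨ht.1.1, ht.2⟩)
    (((hφ.mono hN₁N).add_const ℓ).congr hFe (hFe t₀ ht₀N₁))
  set m₁ := inner ℝ (f t₀ (b₁ t₀)) ((∫ β in a..b₀ t₀, h t₀ β) + m₀ * f t₀ (b₀ t₀)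
    - ∫ β in a..b₁ t₀, h t₀ β) / ‖f t₀ (b₁ t₀)‖ ^ 2 with hm₁
  refine ⟨m₁, ?_, ?_⟩
  · have hha := integral_add_of_continuousOn hJ hht ha (hb₀ t₀ ht₀) (hb₁ t₀ ht₀)
    rw [hm₁, ← hha, RCLike.inner_apply, conj_trivial, Real.norm_of_nonneg hf₁.le]
    field_simp
    ring
  · have h1 := (hGd (b₁ t₀) ht₀N₁.2).comp_hasDerivWithinAt (f := fun t => (t, b₁ t)) t₀
      ((hasDerivWithinAt_id t₀ N₁).prodMk himp) (fun t ht => ⟨ht.1.1, ht.2⟩)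
    have h0 := (hGd (b₀ t₀) ht₀N.2).comp_hasDerivWithinAt (f := fun t => (t, b₀ t)) t₀
      ((hasDerivWithinAt_id t₀ N₁).prodMk (hm₀.mono (hN₁N.trans hNK)))
      (fun t ht => ⟨ht.1.1, ht.1.2⟩)
    have h2 := (h1.sub h0).mono_of_mem_nhdsWithin hN₁K
    have he : ∀ t ∈ K, ∫ β in b₀ t..b₁ t, c β = (∫ β in a..b₁ t, c β) - ∫ β in a..b₀ t, c β :=
      fun t ht => eq_sub_of_add_eq' (integral_add_of_continuousOn hJ hc ha (hb₀ t ht) (hb₁ t ht))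
    refine (h2.congr he (he t₀ ht₀)).congr_deriv ?_
    simp
    ring

end EulerVortex

/-! ### Evolution of ∫ ds/|ω| and the double exponential bound -/

namespace EulerVortex

variable {T : EReal} {u : ℝ → E3 → E3} {p : ℝ → E3 → ℝ} {T₀ : ℝ} {J : Set ℝ} {Y : ℝ → ℝ → E3}
  {x : ℝ → ℝ → E3} {L : ℝ → ℝ} {c₀ C₀ Cl Cu : ℝ}

/-- A moving point on a transported vortex line has a differentiable label; the label moves with
the tangential velocity relative to the fluid. -/
theorem IsMaterialVortexLine.exists_hasDerivWithinAt_label (h : IsEulerSolution T u p) (hT : 0 < T)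
    (h0 : 0 ≤ T₀) (hY : IsMaterialVortexLine T u T₀ J Y) {y : ℝ → E3} {b : ℝ → ℝ} {v : E3}
    (hb : ContinuousOn b (timesFrom T T₀))
    (hby : ∀ t ∈ timesFrom T T₀, b t ∈ J ∧ y t = Y t (b t)) {t : ℝ} (ht : t ∈ timesFrom T T₀)
    (hy : HasDerivWithinAt y v (timesFrom T T₀) t) :
    ∃ m : ℝ, HasDerivWithinAt b m (timesFrom T T₀) t ∧
      lineSpeed u T₀ Y t (b t) * m = inner ℝ (v - u t (y t)) (xi u t (y t)) := by
  have hbJ := (hby t ht).1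
  have hpos := hY.lineSpeed_pos h hT h0 hbJ ht
  have hne := hY.vorticity_ne_zero h hT h0 hbJ ht
  set w := lineSpeed u T₀ Y t (b t) • xi u t (Y t (b t)) with hw
  have hwn : ‖w‖ = lineSpeed u T₀ Y t (b t) := by
    rw [hw, norm_smul, norm_xi hne, mul_one, Real.norm_of_nonneg hpos.le]
  have hw0 : w ≠ 0 := by rw [← norm_ne_zero_iff, hwn]; exact hpos.ne'
  have hcu : ContinuousOn (fun z : ℝ × ℝ => u z.1 (Y z.1 z.2)) (timesFrom T T₀ ×ˢ J) :=
    h.smooth_velocity.continuousOn.comp (f := fun z : ℝ × ℝ => (z.1, Y z.1 z.2))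
      (continuousOn_fst.prodMk (hY.continuousOn_uncurry h hT h0))
      (fun _ hz => ⟨timesFrom_subset h0 hz.1, mem_univ _⟩)
  have hΦ := hasFDerivWithinAt_of_partials (Φ := Y) (Φt := fun r β => u r (Y r β)) (J := J)
    convex_timesFrom ht
    (fun r hr β hβ => (hY.trajectory β hβ r hr.1 hr.2).mono fun _ hs => hs.1)
    (hcu (t, b t) ⟨ht, hbJ⟩) (hY.hasDerivWithinAt_label_xi h hT h0 hbJ ht)
  have himp := hasDerivWithinAt_implicit (x' := v) hw0 hΦ (hb t ht) (fun r hr => ⟨hr, (hby r hr).1⟩)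
    (hy.congr (fun r hr => (hby r hr).2.symm) (hby t ht).2.symm)
  refine ⟨_, himp, ?_⟩
  rw [hwn, hw, real_inner_smul_left, (hby t ht).2, real_inner_comm]
  field_simp

/-- The mass of the initial piece of length `ℓ` of the segment `L^t` with respect to the measure
`ds / |ω|`, which is transported by the flow. -/
noncomputable def inverseVorticityMass (u : ℝ → E3 → E3) (x : ℝ → ℝ → E3) (ℓ t : ℝ) : ℝ :=
  ∫ s in (0 : ℝ)..ℓ, ‖vorticity u t (x t s)‖⁻¹

theorem IsVortexSegmentFamily.continuousOn (H : IsVortexSegmentFamily T u T₀ x L) {t : ℝ}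
    (ht : t ∈ timesFrom T T₀) : ContinuousOn (x t) (Icc 0 (L t)) := fun s hs =>
  (H.arclength t ht.1 ht.2 s hs).continuousWithinAt

theorem IsVortexSegmentFamily.norm_vorticity_le_segMax (h : IsEulerSolution T u p) (h0 : 0 ≤ T₀)
    (H : IsVortexSegmentFamily T u T₀ x L) {t : ℝ} (ht : t ∈ timesFrom T T₀) {s : ℝ}
    (hs : s ∈ Icc 0 (L t)) : ‖vorticity u t (x t s)‖ ≤ segMaxVorticity u x L t :=
  le_csSup (isCompact_Icc.image_of_continuousOn
    ((h.contDiff_vorticity (timesFrom_subset h0 ht)).continuous.norm.comp_continuousOn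
      (H.continuousOn ht))).bddAbove (mem_image_of_mem _ hs)

theorem IsVortexSegmentFamily.norm_velocity_le_segMax (h : IsEulerSolution T u p) (h0 : 0 ≤ T₀)
    (H : IsVortexSegmentFamily T u T₀ x L) {t : ℝ} (ht : t ∈ timesFrom T T₀) {s : ℝ}
    (hs : s ∈ Icc 0 (L t)) : ‖u t (x t s)‖ ≤ segMaxSpeed u x L t :=
  le_csSup (isCompact_Icc.image_of_continuousOn
    ((h.contDiff_velocity (timesFrom_subset h0 ht)).continuous.norm.comp_continuousOn
      (H.continuousOn ht))).bddAbove (mem_image_of_mem _ hs)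

theorem IsVortexSegmentFamily.segMaxTangentialSpeed_le (h : IsEulerSolution T u p) (h0 : 0 ≤ T₀)
    (H : IsVortexSegmentFamily T u T₀ x L) {t : ℝ} (ht : t ∈ timesFrom T T₀) :
    segMaxTangentialSpeed u x L t ≤ segMaxSpeed u x L t := by
  refine csSup_le ((nonempty_Icc.2 (H.length_pos t ht.1 ht.2).le).image _) ?_
  rintro _ ⟨s, hs, rfl⟩
  refine (abs_real_inner_le_norm _ _).trans ?_
  rw [norm_xi (H.nonvanishing t ht.1 ht.2 s hs), mul_one]
  exact H.norm_velocity_le_segMax h h0 ht hs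

/-- Harnack inequality with the supremum taken over one of the two points. -/
theorem LogVelocityHypotheses.segMaxVorticity_le (h : IsEulerSolution T u p) (h0 : 0 ≤ T₀)
    (H : LogVelocityHypotheses T u T₀ x L c₀ C₀ Cl Cu) {t : ℝ} (ht : t ∈ timesFrom T T₀) {s : ℝ}
    (hs : s ∈ Icc 0 (L t)) :
    segMaxVorticity u x L t ≤ Real.exp C₀ * ‖vorticity u t (x t s)‖ := by
  refine csSup_le ((nonempty_Icc.2 (H.family.length_pos t ht.1 ht.2).le).image _) ?_
  rintro _ ⟨s', hs', rfl⟩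
  exact norm_vorticity_le_exp_mul (h.contDiff_velocity (timesFrom_subset h0 ht))
    (H.family.nonvanishing t ht.1 ht.2) (H.family.arclength t ht.1 ht.2)
    (H.divergence_bound t ht.1 ht.2) hs' hs

theorem LogVelocityHypotheses.segMaxVorticity_pos (h : IsEulerSolution T u p) (h0 : 0 ≤ T₀)
    (H : LogVelocityHypotheses T u T₀ x L c₀ C₀ Cl Cu) {t : ℝ} (ht : t ∈ timesFrom T T₀) :
    0 < segMaxVorticity u x L t := by
  have hs : (0 : ℝ) ∈ Icc 0 (L t) := left_mem_Icc.2 (H.family.length_pos t ht.1 ht.2).le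
  exact (norm_pos_iff.2 (H.family.nonvanishing t ht.1 ht.2 0 hs)).trans_le
    (H.family.norm_vorticity_le_segMax h h0 ht hs)

/-- The mass is a substitute for ℓ/Ω_L that is differentiable in time; the price is one Harnack
factor. -/
theorem LogVelocityHypotheses.inverseVorticityMass_bounds (h : IsEulerSolution T u p) (h0 : 0 ≤ T₀)
    (H : LogVelocityHypotheses T u T₀ x L c₀ C₀ Cl Cu) {t : ℝ} (ht : t ∈ timesFrom T T₀) {ℓ : ℝ}
    (hℓ : 0 < ℓ) (hℓL : ℓ ≤ L t) :
    ℓ / segMaxVorticity u x L t ≤ inverseVorticityMass u x ℓ t ∧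
      inverseVorticityMass u x ℓ t ≤ ℓ * Real.exp C₀ / segMaxVorticity u x L t := by
  have hR := H.segMaxVorticity_pos h h0 ht
  have hsub : Icc 0 ℓ ⊆ Icc 0 (L t) := Icc_subset_Icc_right hℓL
  have hpos : ∀ s ∈ Icc 0 ℓ, 0 < ‖vorticity u t (x t s)‖ := fun s hs =>
    norm_pos_iff.2 (H.family.nonvanishing t ht.1 ht.2 s (hsub hs))
  have hint : IntervalIntegrable (fun s => ‖vorticity u t (x t s)‖⁻¹) volume 0 ℓ := by
    refine ContinuousOn.intervalIntegrable ?_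
    rw [uIcc_of_le hℓ.le]
    exact ((h.contDiff_vorticity (timesFrom_subset h0 ht)).continuous.norm.comp_continuousOn
      ((H.family.continuousOn ht).mono hsub)).inv₀ fun s hs => (hpos s hs).ne'
  constructor
  · have := intervalIntegral.integral_mono_on hℓ.le
      (f := fun _ => (segMaxVorticity u x L t)⁻¹) intervalIntegrable_const hint
      (fun s hs => inv_anti₀ (hpos s hs) (H.family.norm_vorticity_le_segMax h h0 ht (hsub hs)))
    rw [intervalIntegral.integral_const, sub_zero, smul_eq_mul] at this
    rw [div_eq_mul_inv]
    exact this
  · have := intervalIntegral.integral_mono_on hℓ.le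
      (g := fun _ => Real.exp C₀ / segMaxVorticity u x L t) hint intervalIntegrable_const
      (fun s hs => by
        rw [inv_eq_one_div, div_le_div_iff₀ (hpos s hs) hR, one_mul]
        exact H.segMaxVorticity_le h h0 ht (hsub hs))
    rw [intervalIntegral.integral_const, sub_zero, smul_eq_mul, ← mul_div_assoc] at this
    exact this

/-- The mass of the initial piece changes only by the flux through its end points. -/
theorem LogVelocityHypotheses.exists_hasDerivWithinAt_mass (h : IsEulerSolution T u p) (hT : 0 < T)
    (h0 : 0 ≤ T₀) (H : LogVelocityHypotheses T u T₀ x L c₀ C₀ Cl Cu) (hCl : 0 < Cl) {ℓ : ℝ}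
    (hℓ : 0 < ℓ) (hℓL : ∀ t ∈ timesFrom T T₀, ℓ < L t) {t : ℝ} (ht : t ∈ timesFrom T T₀) :
    ∃ D : ℝ, HasDerivWithinAt (inverseVorticityMass u x ℓ) D (timesFrom T T₀) t ∧
      |D| ≤ (2 * Cl + 4 + C₀) * segMaxSpeed u x L t
        * (Real.exp C₀ / segMaxVorticity u x L t) := by
  obtain ⟨J, Y, lab, hY, hlab, hlab0⟩ := H.family.same_line
  have hT₀ : (T₀ : EReal) < T := lt_of_le_of_lt (EReal.coe_le_coe_iff.2 ht.1) ht.2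
  have hmem0 : ∀ r ∈ timesFrom T T₀, (0 : ℝ) ∈ Icc 0 (L r) := fun r hr =>
    left_mem_Icc.2 (H.family.length_pos r hr.1 hr.2).le
  have hmemℓ : ∀ r ∈ timesFrom T T₀, ℓ ∈ Icc 0 (L r) := fun r hr => ⟨hℓ.le, (hℓL r hr).le⟩
  have hmemL : L t ∈ Icc 0 (L t) := right_mem_Icc.2 (hmem0 t ht).2
  have hlabJ : ∀ r ∈ timesFrom T T₀, ∀ s ∈ Icc 0 (L r), lab r s ∈ J ∧ x r s = Y r (lab r s) :=
    fun r hr => (hlab r hr.1 hr.2).2.2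
  have hv := (H.family.start_differentiable t ht.1 ht.2).hasDerivWithinAt
  set v := derivWithin (fun r => x r 0) (Ici T₀) t with hvdef
  obtain ⟨m₀, hm₀, hm₀'⟩ := hY.exists_hasDerivWithinAt_label h hT h0 hlab0
    (fun r hr => hlabJ r hr 0 (hmem0 r hr)) ht (hv.mono fun r hr => hr.1)
  have hsubst : ∀ r ∈ timesFrom T T₀, ∀ g : ℝ → ℝ, ContinuousOn g J →
      ∫ β in lab r 0..lab r ℓ, g β * lineSpeed u T₀ Y r β = ∫ s in (0 : ℝ)..ℓ, g (lab r s) :=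
    fun r hr g hg => hY.integral_label_eq h hT h0 hT₀ hr (hlab r hr.1 hr.2).1 (hlabJ r hr)
      (H.family.arclength r hr.1 hr.2) hg (hmemℓ r hr)
  have hYc : ∀ r ∈ timesFrom T T₀, ContinuousOn (Y r) J := fun r hr β hβ =>
    (hY.hasDerivWithinAt_label h hT h0 hβ hr).continuousWithinAt
  have hωY : ∀ r ∈ timesFrom T T₀, ∀ β ∈ J, vorticity u r (Y r β) ≠ 0 := fun r hr β hβ =>
    hY.vorticity_ne_zero h hT h0 hβ hr
  have hut := h.contDiff_velocity (timesFrom_subset h0 ht)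
  -- The evolving density is arclength per label, whose integral over the piece is always ℓ; the
  -- static density is `lineDensity`. Since ℓ < L t, the label of the far end of L^t leaves room to
  -- the right of the piece.
  obtain ⟨m₁, hm₁, hM⟩ := exists_hasDerivWithinAt_integral_of_mass_eq (ℓ := ℓ) hY.interval
    (hY.continuousOn_lineSpeed h hT h0 hT₀) (hY.continuousOn_lineStretch h hT h0 hT₀)
    (hY.continuousOn_lineDensity h h0 hT₀)
    (fun r hr β hβ => hY.lineSpeed_pos h hT h0 hβ hr)
    (fun r hr β hβ => hY.hasDerivWithinAt_lineSpeed h hT h0 hβ hr)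
    (b₁ := fun r => lab r ℓ)
    (fun r hr => (hlabJ r hr 0 (hmem0 r hr)).1) (fun r hr => (hlabJ r hr ℓ (hmemℓ r hr)).1)
    (fun r hr => (hlab r hr.1 hr.2).2.1 (hmem0 r hr) (hmemℓ r hr) hℓ)
    (fun r hr => by simpa using hsubst r hr (fun _ => 1) continuousOn_const)
    ht hm₀ (hlabJ t ht (L t) hmemL).1 ((hlab t ht.1 ht.2).2.1 (hmemℓ t ht) hmemL (hℓL t ht))
  -- Helmholtz: ds/|ω| = `lineDensity` dβ, where the right side is independent of time.
  have hmass : ∀ r ∈ timesFrom T T₀, inverseVorticityMass u x ℓ r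
      = ∫ β in lab r 0..lab r ℓ, lineDensity u T₀ Y β := by
    intro r hr
    have hsub : uIcc (lab r 0) (lab r ℓ) ⊆ J := hY.interval.uIcc_subset
      (hlabJ r hr 0 (hmem0 r hr)).1 (hlabJ r hr ℓ (hmemℓ r hr)).1
    have h1 := hsubst r hr (fun β => ‖vorticity u r (Y r β)‖⁻¹)
      (((h.contDiff_vorticity (timesFrom_subset h0 hr)).continuous.norm.comp_continuousOn
        (hYc r hr)).inv₀ fun β hβ => norm_ne_zero_iff.2 (hωY r hr β hβ))
    have h2 : ∫ β in lab r 0..lab r ℓ, lineDensity u T₀ Y β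
        = ∫ β in lab r 0..lab r ℓ, ‖vorticity u r (Y r β)‖⁻¹ * lineSpeed u T₀ Y r β := by
      refine intervalIntegral.integral_congr fun β hβ => ?_
      have := norm_ne_zero_iff.2 (hωY r hr β (hsub hβ))
      simp only [lineSpeed]
      field_simp
    rw [h2, h1]
    refine intervalIntegral.integral_congr fun s hs => ?_
    rw [uIcc_of_le hℓ.le] at hs
    rw [(hlabJ r hr s ⟨hs.1, hs.2.trans (hmemℓ r hr).2⟩).2]
  have hstretch : ∫ β in lab t 0..lab t ℓ, lineStretch u T₀ Y t β
      = ∫ s in (0 : ℝ)..ℓ, stretching u t (x t s) := by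
    have h1 := hsubst t ht (fun β => stretching u t (Y t β))
      (continuousOn_stretching_comp hut (hYc t ht) (hωY t ht))
    calc _ = ∫ β in lab t 0..lab t ℓ, stretching u t (Y t β) * lineSpeed u T₀ Y t β := by
          simp only [lineStretch, mul_comm]
      _ = _ := h1
      _ = _ := by
        refine intervalIntegral.integral_congr fun s hs => ?_
        rw [uIcc_of_le hℓ.le] at hs
        rw [(hlabJ t ht s ⟨hs.1, hs.2.trans (hmemℓ t ht).2⟩).2]
  refine ⟨_, hM.congr hmass (hmass t ht), ?_⟩
  set U := segMaxSpeed u x L t with hU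
  set R := segMaxVorticity u x L t with hR
  have hRpos : 0 < R := H.segMaxVorticity_pos h h0 ht
  have hU0 : 0 ≤ U := (norm_nonneg _).trans
    (H.family.norm_velocity_le_segMax h h0 ht (hmem0 t ht))
  have hS : |∫ s in (0 : ℝ)..ℓ, stretching u t (x t s)| ≤ (2 + C₀) * U :=
    abs_integral_stretching_le hut (H.family.nonvanishing t ht.1 ht.2)
      (H.family.arclength t ht.1 ht.2) (H.curvature_bound t ht.1 ht.2)
      (fun s hs => H.family.norm_velocity_le_segMax h h0 ht hs) (hmemℓ t ht)
  have hA₀ : |lineSpeed u T₀ Y t (lab t 0) * m₀| ≤ (Cl + 1) * U := by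
    rw [hm₀', inner_sub_left]
    have h1 := H.start_speed_bound t ht.1 ht.2
    have h2 := mul_le_mul_of_nonneg_left (H.family.segMaxTangentialSpeed_le h h0 ht) hCl.le
    have h3 : |inner ℝ (u t (x t 0)) (xi u t (x t 0))| ≤ U := by
      refine (abs_real_inner_le_norm _ _).trans ?_
      rw [norm_xi (H.family.nonvanishing t ht.1 ht.2 0 (hmem0 t ht)), mul_one]
      exact H.family.norm_velocity_le_segMax h h0 ht (hmem0 t ht)
    refine (abs_sub _ _).trans ?_
    linarith
  -- Constancy of length: the flux (Cl + 1)U at the initial end plus the stretching (2 + C₀)U.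
  have hA₁ : |lineSpeed u T₀ Y t (lab t ℓ) * m₁| ≤ (Cl + 3 + C₀) * U := by
    rw [hm₁, hstretch]
    refine (abs_sub _ _).trans ?_
    linarith
  -- A flux of mass is a flux of length divided by |ω|, and |ω| ≥ e^{-C₀}R on the segment.
  have hflux : ∀ s ∈ Icc 0 (L t), ∀ m B : ℝ, |lineSpeed u T₀ Y t (lab t s) * m| ≤ B →
      |lineDensity u T₀ Y (lab t s) * m| ≤ B * (Real.exp C₀ / R) := by
    intro s hs m B hB
    have hne := hωY t ht _ (hlabJ t ht s hs).1
    have hρ : 0 < ‖vorticity u t (Y t (lab t s))‖ := norm_pos_iff.2 hne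
    have h1 : lineDensity u T₀ Y (lab t s) * m
        = lineSpeed u T₀ Y t (lab t s) * m * ‖vorticity u t (Y t (lab t s))‖⁻¹ := by
      simp only [lineSpeed]
      field_simp
    rw [h1, abs_mul, abs_of_pos (inv_pos.2 hρ)]
    refine mul_le_mul hB ?_ (inv_pos.2 hρ).le ((abs_nonneg _).trans hB)
    rw [inv_eq_one_div, div_le_div_iff₀ hρ hRpos, one_mul, ← (hlabJ t ht s hs).2]
    exact H.segMaxVorticity_le h h0 ht hs
  refine (abs_sub _ _).trans ((add_le_add (hflux ℓ (hmemℓ t ht) m₁ _ hA₁)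
    (hflux 0 (hmem0 t ht) m₀ _ hA₀)).trans (le_of_eq ?_))
  ring

theorem maxVorticity_pos {t : ℝ} (hω : Continuous (vorticity u t)) {y : E3} (hy : vorticity u t y ≠ 0) :
    0 < maxVorticity u t := by
  rw [pos_iff_ne_zero]
  intro h
  rw [maxVorticity, eLpNorm_eq_zero_iff hω.aestronglyMeasurable (by simp)] at h
  exact hy (congrFun ((Continuous.ae_eq_iff_eq volume hω continuous_zero).1 h) y)

/-- A linear differential inequality. -/
theorem le_mul_exp_of_deriv_le {z : ℝ → ℝ} {a b B : ℝ} (hab : a ≤ b)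
    (hz : ∀ t ∈ Icc a b, ∃ D, HasDerivWithinAt z D (Icc a b) t ∧ D ≤ B * z t) :
    z b ≤ z a * Real.exp (B * (b - a)) := by
  have hd : ∀ t ∈ Icc a b, ∃ D, HasDerivWithinAt (fun t => z t * Real.exp (-(B * (t - a)))) D
      (Icc a b) t ∧ D ≤ 0 := by
    intro t ht
    obtain ⟨D, hD, hDle⟩ := hz t ht
    have he : HasDerivAt (fun t : ℝ => Real.exp (-(B * (t - a))))
        (Real.exp (-(B * (t - a))) * (-B)) t := by
      simpa using (((hasDerivAt_id t).sub_const a).const_mul B).neg.exp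
    refine ⟨_, hD.mul he.hasDerivWithinAt, ?_⟩
    have := Real.exp_pos (-(B * (t - a)))
    nlinarith
  have hanti : AntitoneOn (fun t => z t * Real.exp (-(B * (t - a)))) (Icc a b) := by
    refine antitoneOn_of_deriv_nonpos (convex_Icc a b)
      (fun t ht => (hd t ht).choose_spec.1.continuousWithinAt) ?_ ?_
    · rw [interior_Icc]
      intro t ht
      exact ((hd t (Ioo_subset_Icc_self ht)).choose_spec.1.hasDerivAt
        (Icc_mem_nhds ht.1 ht.2)).differentiableAt.differentiableWithinAt
    · rw [interior_Icc]
      intro t ht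
      have := (hd t (Ioo_subset_Icc_self ht)).choose_spec
      rw [(this.1.hasDerivAt (Icc_mem_nhds ht.1 ht.2)).deriv]
      exact this.2
  have hle := hanti (left_mem_Icc.2 hab) (right_mem_Icc.2 hab) hab
  simp only [sub_self, mul_zero, neg_zero, Real.exp_zero, mul_one, Real.exp_neg] at hle
  rwa [← div_eq_mul_inv, div_le_iff₀ (Real.exp_pos _)] at hle

/-- The Harnack inequality averaged over the segment; at time T₀ it brings in Q(T₀). -/
theorem LogVelocityHypotheses.segMaxVorticity_le_mean (h : IsEulerSolution T u p) (h0 : 0 ≤ T₀)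
    (H : LogVelocityHypotheses T u T₀ x L c₀ C₀ Cl Cu) {t : ℝ} (ht : t ∈ timesFrom T T₀) :
    segMaxVorticity u x L t ≤ Real.exp C₀ * segMeanVorticity u x L t := by
  have hL := H.family.length_pos t ht.1 ht.2
  have hint : IntervalIntegrable (fun s => Real.exp C₀ * ‖vorticity u t (x t s)‖) volume 0 (L t) := by
    refine ContinuousOn.intervalIntegrable ?_
    rw [uIcc_of_le hL.le]
    exact continuousOn_const.mul
      ((h.contDiff_vorticity (timesFrom_subset h0 ht)).continuous.norm.comp_continuousOn
        (H.family.continuousOn ht))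
  have := intervalIntegral.integral_mono_on hL.le
    (f := fun _ => segMaxVorticity u x L t) intervalIntegrable_const hint
    (fun s hs => H.segMaxVorticity_le h h0 ht hs)
  rw [intervalIntegral.integral_const, sub_zero, smul_eq_mul,
    intervalIntegral.integral_const_mul] at this
  rw [segMeanVorticity, one_div, ← mul_assoc, mul_comm (Real.exp C₀), mul_assoc,
    ← div_eq_inv_mul, le_div_iff₀ hL, mul_comm]
  exact this

/-- The vorticity grows at most double exponentially. -/
theorem LogVelocityHypotheses.maxVorticity_le (h : IsEulerSolution T u p) (h0 : 0 ≤ T₀)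
    (hT₀ : (T₀ : EReal) < T) (H : LogVelocityHypotheses T u T₀ x L c₀ C₀ Cl Cu) {L₀ : ℝ}
    (hc₀ : 0 < c₀) (hC₀ : 0 < C₀) (hCl : 0 < Cl) (hCu : 0 < Cu) (hL₀ : 0 < L₀)
    (hL : ∀ t : ℝ, T₀ ≤ t → (t : EReal) < T → L₀ ≤ L t) {t : ℝ} (ht : t ∈ timesFrom T T₀) :
    maxVorticity u t ≤ ENNReal.ofReal (Real.exp
      (Real.log (Real.exp (2 * C₀) / c₀ * segMeanVorticity u x L T₀) *
        Real.exp ((2 * Cl + 4 + C₀) * Real.exp C₀ * Cu / (L₀ / 2) * (t - T₀)))) := by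
  have hT : 0 < T := time_pos_of_le_of_lt h0 hT₀
  -- Half of L₀ makes ℓ < L t strict, as the differentiability of the mass requires.
  set ℓ := L₀ / 2 with hℓdef
  have hℓ : 0 < ℓ := by positivity
  have hℓL : ∀ r ∈ timesFrom T T₀, ℓ < L r := fun r hr => by linarith [hL r hr.1 hr.2]
  set M := inverseVorticityMass u x ℓ with hM
  set R := segMaxVorticity u x L with hR
  set B := (2 * Cl + 4 + C₀) * Real.exp C₀ * Cu / ℓ with hB
  -- A differentiable majorant of log Ω: c₀Ω ≤ R and RM ≤ e^{C₀}ℓ give Ω ≤ e^z.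
  set z : ℝ → ℝ := fun r => Real.log (Real.exp C₀ * ℓ / c₀) - Real.log (M r) with hz
  have hec : 0 < Real.exp C₀ := Real.exp_pos _
  have hRpos : ∀ r ∈ timesFrom T T₀, 0 < R r := fun r hr => H.segMaxVorticity_pos h h0 hr
  have hMb : ∀ r ∈ timesFrom T T₀, ℓ / R r ≤ M r ∧ M r ≤ ℓ * Real.exp C₀ / R r := fun r hr =>
    H.inverseVorticityMass_bounds h h0 hr hℓ (hℓL r hr).le
  have hMpos : ∀ r ∈ timesFrom T T₀, 0 < M r := fun r hr =>
    (div_pos hℓ (hRpos r hr)).trans_le (hMb r hr).1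
  have hexpz : ∀ r ∈ timesFrom T T₀, Real.exp (z r) = Real.exp C₀ * ℓ / c₀ / M r := fun r hr => by
    rw [hz, Real.exp_sub, Real.exp_log (by positivity), Real.exp_log (hMpos r hr)]
  have hΩ : ∀ r ∈ timesFrom T T₀, maxVorticity u r ≠ ⊤ ∧
      (maxVorticity u r).toReal ≤ Real.exp (z r) := by
    intro r hr
    have h1 := H.comparable r hr.1 hr.2
    have hfin : maxVorticity u r ≠ ⊤ := by
      intro htop
      rw [htop, ENNReal.mul_top (ENNReal.ofReal_pos.2 hc₀).ne'] at h1
      exact ENNReal.ofReal_ne_top (top_le_iff.1 h1)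
    refine ⟨hfin, ?_⟩
    have h2 := ENNReal.toReal_mono ENNReal.ofReal_ne_top h1
    rw [ENNReal.toReal_mul, ENNReal.toReal_ofReal hc₀.le,
      ENNReal.toReal_ofReal (hRpos r hr).le] at h2
    rw [hexpz r hr, div_div, le_div_iff₀ (mul_pos hc₀ (hMpos r hr)), ← mul_assoc,
      mul_comm _ c₀]
    have h3 := (hMb r hr).2
    rw [le_div_iff₀ (hRpos r hr)] at h3
    calc c₀ * (maxVorticity u r).toReal * M r ≤ R r * M r :=
          mul_le_mul_of_nonneg_right h2 (hMpos r hr).le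
      _ ≤ Real.exp C₀ * ℓ := by linarith
  have hU : ∀ r ∈ timesFrom T T₀, segMaxSpeed u x L r ≤ Cu * z r := by
    intro r hr
    have hs : (0 : ℝ) ∈ Icc 0 (L r) := left_mem_Icc.2 (H.family.length_pos r hr.1 hr.2).le
    have hpos : 0 < (maxVorticity u r).toReal := ENNReal.toReal_pos
      (maxVorticity_pos (h.contDiff_vorticity (timesFrom_subset h0 hr)).continuous
        (H.family.nonvanishing r hr.1 hr.2 0 hs)).ne' (hΩ r hr).1
    refine (H.log_velocity r hr.1 hr.2).trans (mul_le_mul_of_nonneg_left ?_ hCu.le)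
    rw [← Real.log_exp (z r)]
    exact Real.log_le_log hpos (hΩ r hr).2
  have hsub := Icc_subset_timesFrom (T₀ := T₀) ht.2
  have hgr : z t ≤ z T₀ * Real.exp (B * (t - T₀)) := by
    refine le_mul_exp_of_deriv_le ht.1 fun r hr' => ?_
    have hr := hsub hr'
    obtain ⟨D, hD, hDb⟩ := H.exists_hasDerivWithinAt_mass h hT h0 hCl hℓ hℓL hr
    have hlog := (hD.log (hMpos r hr).ne').const_sub (Real.log (Real.exp C₀ * ℓ / c₀))
    refine ⟨_, hlog.mono hsub, ?_⟩
    have hU0 : 0 ≤ segMaxSpeed u x L r := (norm_nonneg _).trans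
      (H.family.norm_velocity_le_segMax h h0 hr
        (left_mem_Icc.2 (H.family.length_pos r hr.1 hr.2).le))
    have hMr := hMpos r hr
    have hRr := hRpos r hr
    have h1 : -(D / M r) ≤ (2 * Cl + 4 + C₀) * segMaxSpeed u x L r * (Real.exp C₀ / R r) / M r := by
      rw [← neg_div]
      exact div_le_div_of_nonneg_right ((neg_le_abs D).trans hDb) hMr.le
    -- The lower bound M ≥ ℓ/R cancels the vorticity from the logarithmic derivative, leaving only
    -- the velocity.
    have h2 : Real.exp C₀ / R r / M r ≤ Real.exp C₀ / ℓ := by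
      rw [div_div]
      refine div_le_div_of_nonneg_left hec.le hℓ ?_
      have := (hMb r hr).1
      rw [div_le_iff₀ hRr] at this
      linarith
    have h3 : 0 ≤ (2 * Cl + 4 + C₀) * segMaxSpeed u x L r := by positivity
    calc -(D / M r) ≤ (2 * Cl + 4 + C₀) * segMaxSpeed u x L r * (Real.exp C₀ / R r / M r) := by
          rw [← mul_div_assoc]; exact h1
      _ ≤ (2 * Cl + 4 + C₀) * segMaxSpeed u x L r * (Real.exp C₀ / ℓ) :=
          mul_le_mul_of_nonneg_left h2 h3
      _ ≤ (2 * Cl + 4 + C₀) * (Cu * z r) * (Real.exp C₀ / ℓ) := by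
          have := hU r hr
          gcongr
      _ = B * z r := by rw [hB]; ring
  have hT₀m : T₀ ∈ timesFrom T T₀ := ⟨le_rfl, hT₀⟩
  -- From M ≥ ℓ/R and R ≤ e^{C₀}Q at T₀; the second factor e^{C₀} comes from the definition of z.
  have hz₀ : z T₀ ≤ Real.log (Real.exp (2 * C₀) / c₀ * segMeanVorticity u x L T₀) := by
    rw [← Real.log_exp (z T₀)]
    refine Real.log_le_log (Real.exp_pos _) ?_
    rw [hexpz T₀ hT₀m, div_le_iff₀ (hMpos T₀ hT₀m)]
    have h1 := (hMb T₀ hT₀m).1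
    rw [div_le_iff₀ (hRpos T₀ hT₀m)] at h1
    have h2 : R T₀ ≤ Real.exp C₀ * segMeanVorticity u x L T₀ := H.segMaxVorticity_le_mean h h0 hT₀m
    have h3 : ℓ ≤ Real.exp C₀ * segMeanVorticity u x L T₀ * M T₀ :=
      h1.trans (by rw [mul_comm]; exact mul_le_mul_of_nonneg_right h2 (hMpos T₀ hT₀m).le)
    have h4 : Real.exp (2 * C₀) = Real.exp C₀ * Real.exp C₀ := by rw [← Real.exp_add]; ring_nf
    calc Real.exp C₀ * ℓ / c₀
        ≤ Real.exp C₀ * (Real.exp C₀ * segMeanVorticity u x L T₀ * M T₀) / c₀ := by gcongr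
      _ = _ := by rw [h4]; ring
  rw [← ENNReal.ofReal_toReal (hΩ t ht).1]
  refine ENNReal.ofReal_le_ofReal ((hΩ t ht).2.trans (Real.exp_le_exp.2 (hgr.trans ?_)))
  exact mul_le_mul_of_nonneg_right hz₀ (Real.exp_pos _).le

end EulerVortex

theorem mainTheorem4 :
    ∃ (A : ℝ → ℝ → ℝ) (B : ℝ → ℝ → ℝ → ℝ → ℝ),
      ∀ c₀ C₀ Cl Cu L₀ : ℝ, 0 < c₀ → c₀ ≤ 1 → 0 < C₀ → 0 < Cl → 0 < Cu → 0 < L₀ →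
        0 < A c₀ C₀ ∧ 0 < B C₀ Cl Cu L₀ ∧
        ∀ (T : EReal) (u : ℝ → EulerVortex.E3 → EulerVortex.E3) (p : ℝ → EulerVortex.E3 → ℝ)
          (T₀ : ℝ) (x : ℝ → ℝ → EulerVortex.E3) (L : ℝ → ℝ),
          EulerVortex.IsEulerSolution T u p →
          0 ≤ T₀ → (T₀ : EReal) < T →
          EulerVortex.LogVelocityHypotheses T u T₀ x L c₀ C₀ Cl Cu →
          (∀ t : ℝ, T₀ ≤ t → (t : EReal) < T → L₀ ≤ L t) →
          ∀ t : ℝ, T₀ ≤ t → (t : EReal) < T →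
            EulerVortex.maxVorticity u t ≤
              ENNReal.ofReal (Real.exp
                (Real.log (A c₀ C₀ * EulerVortex.segMeanVorticity u x L T₀) *
                  Real.exp (B C₀ Cl Cu L₀ * (t - T₀)))) := by
  -- In B, 2Cl + 4 + C₀ collects both end fluxes, e^{C₀} is the Harnack factor at the ends, and L₀/2
  -- is the length of the piece.
  refine ⟨fun c₀ C₀ => Real.exp (2 * C₀) / c₀,
    fun C₀ Cl Cu L₀ => (2 * Cl + 4 + C₀) * Real.exp C₀ * Cu / (L₀ / 2), ?_⟩
  intro c₀ C₀ Cl Cu L₀ hc₀ _ hC₀ hCl hCu hL₀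
  refine ⟨by positivity, by positivity, ?_⟩
  intro T u p T₀ x L h h0 hT₀ H hL t ht htT
  exact H.maxVorticity_le h h0 hT₀ hc₀ hC₀ hCl hCu hL₀ hL ⟨ht, htT⟩
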